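/- Let $(M,\Pi)$ be a Poisson manifold: a smooth (Hausdorff, paracompact, finite-dimensional) manifold with a smooth bivector field $\Pi$ such that the bracket $\{f,g\}=\Pi(df,dg)$ satisfies the Jacobi identity. Let $\#:T^*M\to TM$ be the contraction, $\langle\beta,\#\alpha\rangle=\Pi(\alpha,\beta)$, let $[\alpha,\beta]=\mathcal L_{\#\alpha}\beta-\mathcal L_{\#\beta}\alpha-d\,\Pi(\alpha,\beta)$ be the associated Lie bracket on 1-forms, and let $\pi:T^*M\to M$ be the projection. A cotangent path is a $C^1$ path $a:[0,1]\to T^*M$ with $\frac{d}{dt}\pi(a(t))=\#a(t)$. The integral along $a$ of a vector field $X$ on $M$ is $\int_aX=\int_0^1\langle a(t),X(\gamma(t))\rangle\,dt$, where $\gamma=\pi\circ a$ is the base path of $a$. Fix a smooth covariant connection $\nabla$ on $TM$, write $\nabla$ also for the dual connection on $T^*M$, and let $$T_\nabla(\alpha,\beta)=\nabla_{\#\alpha}\beta-\nabla_{\#\beta}\alpha-[\alpha,\beta],$$ which is tensorial in $\alpha$ and $\beta$. Let $a_\epsilon(t)$, $(\epsilon,t)\in[0,1]^2$, be a family of cotangent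 paths, of class $C^1$ in $(\epsilon,t)$, whose base paths have fixed end points. Let $b=b(\epsilon,t)\in T^*M$ be the solution, over the same base points, of $$\partial_tb-\partial_\epsilon a=T_\nabla(a,b),\qquad b(\epsilon,0)=0,$$ where $\partial_t$ and $\partial_\epsilon$ are the covariant derivatives along the base curves. The family is a cotangent homotopy if $b(\epsilon,1)=0$ for all $\epsilon\in[0,1]$. Two cotangent paths $a_0$ and $a_1$ are homotopic, $a_0\sim a_1$, if a cotangent homotopy joins them. A vector field $X$ is a Poisson vector field if $\mathcal L_X\Pi=0$, and $H^1_\Pi(M)$ is the space of smooth Poisson vector fields modulo the Hamiltonian vector fields $X_h=\{\cdot,h\}=-\#dh$, $h\in C^\infty(M)$. For $x\in M$, let $\Sigma(M,x)$ be the group of classes, under $\sim$, of cotangent paths whose base path starts and ends at $x$, with the product given by concatenation (the paths being first reparametrized by a cutoff function so that the concatenation is $C^1$). Proposition. If $a_0$ and $a_1$ are cotangent paths with $a_0\sim a_1$, then $\int_{a_0}X=\int_{a_1}X$ for every smooth Poisson vector field $X$ on $M$. Consequently, for every $x\in M$, integration defines a group homomorphism $$\int:\Sigma(M,x)\to H^1_\Pi(M)^*,\qquad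 [a]\mapsto\Big([X]\mapsto\int_aX\Big),$$ where $H^1_\Pi(M)^*$ is the (algebraic) dual vector space with its additive group structure. -/

import Mathlib

open Set Bundle MeasureTheory
open scoped Manifold ContDiff Topology

noncomputable section

namespace PoissonGeometry

section Definitions

variable {E : Type*} [NormedAddCommGroup E] [NormedSpace ℝ E]
  {M : Type*} [TopologicalSpace M] [ChartedSpace E M]

variable (E) in
/-- The cotangent space `T*_x M` of a manifold modelled on `E`. -/
abbrev CotangentSpace (x : M) : Type _ := TangentSpace 𝓘(ℝ, E) x →L[ℝ] Bundle.Trivial M ℝ x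

variable [IsManifold 𝓘(ℝ, E) ∞ M]

variable (E M) in
/-- The cotangent bundle `T*M`, with its Mathlib topology and smooth structure. -/
abbrev CotangentBundle : Type _ :=
  TotalSpace (E →L[ℝ] ℝ) (fun x : M ↦ CotangentSpace E x)

variable (E M) in
/-- Smooth vector fields on `M`. -/
abbrev SmoothVectorField : Type _ :=
  ContMDiffSection 𝓘(ℝ, E) E ∞ (TangentSpace 𝓘(ℝ, E) : M → Type _)

variable (E M) in
/-- Affine connections (covariant derivatives on `TM`). In Mathlib's argument order,
`nabla Y x v` is `∇_v Y` at the point `x`. -/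
abbrev AffineConnection : Type _ :=
  CovariantDerivative 𝓘(ℝ, E) E (TangentSpace 𝓘(ℝ, E) : M → Type _)

/-- The function `{f, g} = Π(df, dg) = ⟨dg, #df⟩` attached to a bundle map `# : T*M → TM`. -/
def bracketOf (sharp : ∀ x : M, CotangentSpace E x →L[ℝ] TangentSpace 𝓘(ℝ, E) x)
    (f g : M → ℝ) (x : M) : ℝ :=
  mvfderiv 𝓘(ℝ, E) g x (sharp x (mvfderiv 𝓘(ℝ, E) f x))

variable (E M) in
/-- A Poisson structure on `M`, given by the contraction `# : T*M → TM`, `⟨β, #α⟩ = Π(α, β)`, with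
a smooth bivector field `Π` such that `{f, g} = Π(df, dg)` satisfies the Jacobi identity. -/
structure PoissonStructure where
  /-- the bundle map `# : T*M → TM` -/
  sharp : ∀ x : M, CotangentSpace E x →L[ℝ] TangentSpace 𝓘(ℝ, E) x
  contMDiff_sharp : ContMDiff 𝓘(ℝ, E) (𝓘(ℝ, E).prod 𝓘(ℝ, (E →L[ℝ] ℝ) →L[ℝ] E)) ∞
    (fun x ↦ TotalSpace.mk' ((E →L[ℝ] ℝ) →L[ℝ] E)
      (E := fun x : M ↦ CotangentSpace E x →L[ℝ] TangentSpace 𝓘(ℝ, E) x) x (sharp x))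
  skew : ∀ (x : M) (α β : CotangentSpace E x), β (sharp x α) = - α (sharp x β)
  jacobi : ∀ f g h : M → ℝ, ContMDiff 𝓘(ℝ, E) 𝓘(ℝ, ℝ) ∞ f → ContMDiff 𝓘(ℝ, E) 𝓘(ℝ, ℝ) ∞ g →
    ContMDiff 𝓘(ℝ, E) 𝓘(ℝ, ℝ) ∞ h → ∀ x,
      bracketOf sharp f (bracketOf sharp g h) x + bracketOf sharp g (bracketOf sharp h f) x
        + bracketOf sharp h (bracketOf sharp f g) x = 0

/-- The value at `x` of `∇_V β`, for a 1-form `β`, on the vector field `Y`: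
`(∇_V β)(Y) = V(β(Y)) - β(∇_V Y)`. -/
def covDerivForm (nabla : AffineConnection E M) (V : ∀ x : M, TangentSpace 𝓘(ℝ, E) x)
    (β : ∀ x : M, CotangentSpace E x) (Y : ∀ x : M, TangentSpace 𝓘(ℝ, E) x) (x : M) : ℝ :=
  mvfderiv 𝓘(ℝ, E) (fun y ↦ (β y (Y y) : ℝ)) x (V x) - β x (nabla Y x (V x))

/-- The value at `x` of the Lie derivative `L_V β`, for a 1-form `β`, on the vector field `Y`:
`(L_V β)(Y) = V(β(Y)) - β([V, Y])`. -/
def lieDerivForm (V : ∀ x : M, TangentSpace 𝓘(ℝ, E) x)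
    (β : ∀ x : M, CotangentSpace E x) (Y : ∀ x : M, TangentSpace 𝓘(ℝ, E) x) (x : M) : ℝ :=
  mvfderiv 𝓘(ℝ, E) (fun y ↦ (β y (Y y) : ℝ)) x (V x)
    - β x (VectorField.mlieBracket 𝓘(ℝ, E) V Y x)

/-- The velocity at time `t` of a path in `M` parametrized by `[0, 1]` (one-sided at the ends). -/
def velocity (γ : ℝ → M) (t : ℝ) : TangentSpace 𝓘(ℝ, E) (γ t) :=
  mfderivWithin 𝓘(ℝ, ℝ) 𝓘(ℝ, E) γ unitInterval t (1 : ℝ)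

/-- The value on the vector field `Y` of the covariant derivative `∂_t c` of a path `c` of covectors
over a path `γ` in `M`, for the connection on `T*M` dual to `∇`:
`(∂_t c)(Y) = d/dt ⟨c, Y(γ)⟩ - ⟨c, ∇_{dγ/dt} Y⟩`. -/
def covDerivAlong (nabla : AffineConnection E M) (γ : ℝ → M) (c : ∀ t, CotangentSpace E (γ t))
    (Y : ∀ x : M, TangentSpace 𝓘(ℝ, E) x) (t : ℝ) : ℝ :=
  derivWithin (fun s ↦ (c s (Y (γ s)) : ℝ)) unitInterval t - c t (nabla Y (γ t) (velocity γ t))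

namespace PoissonStructure

variable (P : PoissonStructure E M)

/-- The Poisson bracket `{f, g} = Π(df, dg)`. -/
def bracket (f g : M → ℝ) : M → ℝ := bracketOf P.sharp f g

/-- The value at `x` of the bracket of 1-forms `[α, β] = L_{#α} β - L_{#β} α - d Π(α, β)` on the
vector field `Y`. -/
def koszulBracket (α β : ∀ x : M, CotangentSpace E x)
    (Y : ∀ x : M, TangentSpace 𝓘(ℝ, E) x) (x : M) : ℝ :=
  lieDerivForm (fun y ↦ P.sharp y (α y)) β Y x - lieDerivForm (fun y ↦ P.sharp y (β y)) α Y x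
    - mvfderiv 𝓘(ℝ, E) (fun y ↦ (β y (P.sharp y (α y)) : ℝ)) x (Y x)

/-- The value at `x` of `∇_{#α} β - ∇_{#β} α - [α, β]`, for 1-forms `α` and `β`, on the vector
field `Y`. -/
def torsionForm (nabla : AffineConnection E M) (α β : ∀ x : M, CotangentSpace E x)
    (Y : ∀ x : M, TangentSpace 𝓘(ℝ, E) x) (x : M) : ℝ :=
  covDerivForm nabla (fun y ↦ P.sharp y (α y)) β Y x
    - covDerivForm nabla (fun y ↦ P.sharp y (β y)) α Y x - P.koszulBracket α β Y x

/-- The contravariant torsion `T_∇(α, β)` of two covectors at `x`, evaluated on the vector field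
`Y`. The expression is tensorial, so that the choice of the 1-forms that extend `α` and `β` does
not matter. -/
def torsion (nabla : AffineConnection E M) {x : M} (α β : CotangentSpace E x)
    (Y : ∀ x : M, TangentSpace 𝓘(ℝ, E) x) : ℝ :=
  P.torsionForm nabla (FiberBundle.extend (E →L[ℝ] ℝ) α) (FiberBundle.extend (E →L[ℝ] ℝ) β) Y x

/-- The equation `∂_t b - ∂_ε a = T_∇(a, b)` at the parameter `(ε, t)`, for families `a`, `b` of
covectors over a family `γ` of points of `M`. An equation between covectors is expressed by its
values on all smooth vector fields. -/
def VariationEquationAt (nabla : AffineConnection E M) (γ : ℝ → ℝ → M)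
    (a b : ∀ ε t, CotangentSpace E (γ ε t)) (ε t : ℝ) : Prop :=
  ∀ Y : SmoothVectorField E M,
    DifferentiableWithinAt ℝ (fun s ↦ (b ε s (Y (γ ε s)) : ℝ)) unitInterval t ∧
    covDerivAlong nabla (fun s ↦ γ ε s) (fun s ↦ b ε s) Y t
        - covDerivAlong nabla (fun e ↦ γ e t) (fun e ↦ a e t) Y ε
      = P.torsion nabla (a ε t) (b ε t) Y

/-- A family `a_ε`, `ε ∈ [0, 1]`, of cotangent paths, of class `C¹` in `(ε, t)`, is a cotangent
homotopy if the base paths have fixed end points and the solution `b` of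
`∂_t b - ∂_ε a = T_∇(a, b)`, `b(ε, 0) = 0`, has `b(ε, 1) = 0`, that is, `var(a_ε) = 0`. -/
structure IsCotangentHomotopy (nabla : AffineConnection E M) (a : ℝ → ℝ → CotangentBundle E M) :
    Prop where
  contMDiffOn : ContMDiffOn 𝓘(ℝ, ℝ × ℝ) (𝓘(ℝ, E).prod 𝓘(ℝ, E →L[ℝ] ℝ)) 1
    (fun z : ℝ × ℝ ↦ a z.1 z.2) (unitInterval ×ˢ unitInterval)
  hasMFDerivWithinAt : ∀ ε ∈ unitInterval, ∀ t ∈ unitInterval,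
    HasMFDerivWithinAt 𝓘(ℝ, ℝ) 𝓘(ℝ, E) (fun s ↦ (a ε s).proj) unitInterval t
      ((1 : ℝ →L[ℝ] ℝ).smulRight (P.sharp (a ε t).proj (a ε t).2))
  source_eq : ∀ ε ∈ unitInterval, (a ε 0).proj = (a 0 0).proj
  target_eq : ∀ ε ∈ unitInterval, (a ε 1).proj = (a 0 1).proj
  variation_eq_zero : ∃ b : ∀ ε t, CotangentSpace E (a ε t).proj,
    (∀ ε ∈ unitInterval, ∀ t ∈ unitInterval,
      P.VariationEquationAt nabla (fun ε t ↦ (a ε t).proj) (fun ε t ↦ (a ε t).2) b ε t) ∧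
    (∀ ε ∈ unitInterval, b ε 0 = 0) ∧ ∀ ε ∈ unitInterval, b ε 1 = 0

end PoissonStructure

/-- A cotangent path, of class `C¹`: a path `a : [0, 1] → T*M` with `d/dt π(a(t)) = # a(t)`. It is
recorded as a function on `ℝ`, whose values outside `[0, 1]` are irrelevant. -/
structure CotangentPath (P : PoissonStructure E M) where
  toFun : ℝ → CotangentBundle E M
  contMDiffOn : ContMDiffOn 𝓘(ℝ, ℝ) (𝓘(ℝ, E).prod 𝓘(ℝ, E →L[ℝ] ℝ)) 1 toFun unitInterval
  hasMFDerivWithinAt : ∀ t ∈ unitInterval,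
    HasMFDerivWithinAt 𝓘(ℝ, ℝ) 𝓘(ℝ, E) (fun s ↦ (toFun s).proj) unitInterval t
      ((1 : ℝ →L[ℝ] ℝ).smulRight (P.sharp (toFun t).proj (toFun t).2))

namespace CotangentPath

variable {P : PoissonStructure E M}

instance : CoeFun (CotangentPath P) (fun _ ↦ ℝ → CotangentBundle E M) := ⟨toFun⟩

/-- The integral `∫_a X = ∫_0^1 ⟨a(t), X(γ(t))⟩ dt` of a vector field along a cotangent path with
base path `γ`. -/
def integral (a : CotangentPath P) (X : ∀ x : M, TangentSpace 𝓘(ℝ, E) x) : ℝ :=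
  ∫ t in (0 : ℝ)..1, ((a t).2 (X (a t).proj) : ℝ)

/-- `a₀ ∼ a₁`: there is a cotangent homotopy that joins `a₀` and `a₁`. -/
def Homotopic (nabla : AffineConnection E M) (a₀ a₁ : CotangentPath P) : Prop :=
  ∃ a : ℝ → ℝ → CotangentBundle E M, P.IsCotangentHomotopy nabla a ∧
    ∀ t ∈ unitInterval, a 0 t = a₀ t ∧ a 1 t = a₁ t

end CotangentPath

/-- Cotangent paths whose base path starts and ends at `x`. -/
structure CotangentLoop (P : PoissonStructure E M) (x : M) extends CotangentPath P where
  source : (toFun 0).proj = x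
  target : (toFun 1).proj = x

set_option linter.unusedSectionVars false

/-! ### Algebraic properties of the torsion -/

lemma extend_smul (x : M) (r : ℝ) (α : CotangentSpace E x) :
    ∀ᶠ y in 𝓝 x, (FiberBundle.extend (E →L[ℝ] ℝ) (r • α) y : CotangentSpace E y)
      = (r • FiberBundle.extend (E →L[ℝ] ℝ) α : ∀ y : M, CotangentSpace E y) y := by
  have hx : x ∈ (trivializationAt (E →L[ℝ] ℝ) (fun x : M ↦ CotangentSpace E x) x).baseSet :=
    FiberBundle.mem_baseSet_trivializationAt' x
  filter_upwards [(trivializationAt (E →L[ℝ] ℝ)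
    (fun x : M ↦ CotangentSpace E x) x).open_baseSet.mem_nhds hx] with y hy
  simp only [FiberBundle.extend, Pi.smul_apply]
  have :=
    ((trivializationAt (E →L[ℝ] ℝ) (fun x : M ↦ CotangentSpace E x) x).linear ℝ hx).map_smul r α
  rw [this, ← Trivialization.coe_symmₗ (R := ℝ) _ hy, LinearMap.map_smul]

lemma mvfderiv_congr {f g : M → ℝ} {x : M} (h : f =ᶠ[𝓝 x] g) :
    mvfderiv 𝓘(ℝ, E) f x = mvfderiv 𝓘(ℝ, E) g x := by
  simp only [mvfderiv, h.mfderiv_eq]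
  rfl

lemma torsionForm_congr (P : PoissonStructure E M) (nabla : AffineConnection E M) {x : M}
    {α β α' β' : ∀ x : M, CotangentSpace E x} (hα : ∀ᶠ y in 𝓝 x, α y = α' y)
    (hβ : ∀ᶠ y in 𝓝 x, β y = β' y)
    (Y : ∀ x : M, TangentSpace 𝓘(ℝ, E) x) :
    P.torsionForm nabla α β Y x = P.torsionForm nabla α' β' Y x := by
  have e1 : (fun y ↦ (α y (Y y) : ℝ)) =ᶠ[𝓝 x] fun y ↦ (α' y (Y y) : ℝ) := by
    filter_upwards [hα] with y hy
    rw [hy]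
  have e2 : (fun y ↦ (β y (Y y) : ℝ)) =ᶠ[𝓝 x] fun y ↦ (β' y (Y y) : ℝ) := by
    filter_upwards [hβ] with y hy
    rw [hy]
  have e3 : ∀ᶠ y in 𝓝 x, P.sharp y (α y) = P.sharp y (α' y) := by
    filter_upwards [hα] with y hy
    rw [hy]
  have e4 : ∀ᶠ y in 𝓝 x, P.sharp y (β y) = P.sharp y (β' y) := by
    filter_upwards [hβ] with y hy
    rw [hy]
  have e5 : (fun y ↦ (β y (P.sharp y (α y)) : ℝ)) =ᶠ[𝓝 x]
      fun y ↦ (β' y (P.sharp y (α' y)) : ℝ) := by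
    filter_upwards [hα, hβ] with y hy hy'
    rw [hy, hy']
  simp only [PoissonStructure.torsionForm, PoissonStructure.koszulBracket, covDerivForm,
    lieDerivForm]
  rw [mvfderiv_congr e1, mvfderiv_congr e2, mvfderiv_congr e5, hα.self_of_nhds, hβ.self_of_nhds,
    Filter.EventuallyEq.mlieBracket_vectorField_eq e3 (Filter.EventuallyEq.refl _ Y),
    Filter.EventuallyEq.mlieBracket_vectorField_eq e4 (Filter.EventuallyEq.refl _ Y)]

variable [FiniteDimensional ℝ E]

lemma mdiff_pair {x : M} {α : ∀ x : M, CotangentSpace E x} {Y : ∀ x : M, TangentSpace 𝓘(ℝ, E) x}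
    (hα : MDifferentiableAt 𝓘(ℝ, E) (𝓘(ℝ, E).prod 𝓘(ℝ, E →L[ℝ] ℝ))
      (fun y ↦ (⟨y, α y⟩ : CotangentBundle E M)) x)
    (hY : MDifferentiableAt 𝓘(ℝ, E) (𝓘(ℝ, E).prod 𝓘(ℝ, E))
      (fun y ↦ (⟨y, Y y⟩ : TotalSpace E (TangentSpace 𝓘(ℝ, E) : M → Type _))) x) :
    MDifferentiableAt 𝓘(ℝ, E) 𝓘(ℝ, ℝ) (fun y ↦ (α y (Y y) : ℝ)) x := by
  have := MDifferentiableAt.clm_bundle_apply (F₁ := E) (F₂ := ℝ)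
    (E₁ := (TangentSpace 𝓘(ℝ, E) : M → Type _)) (E₂ := Bundle.Trivial M ℝ) hα hY
  have h2 := (mdifferentiableAt_totalSpace 𝓘(ℝ, E) _).1 this
  simpa using h2.2

lemma mdiff_sharp (P : PoissonStructure E M) {x : M} {α : ∀ x : M, CotangentSpace E x}
    (hα : MDifferentiableAt 𝓘(ℝ, E) (𝓘(ℝ, E).prod 𝓘(ℝ, E →L[ℝ] ℝ))
      (fun y ↦ (⟨y, α y⟩ : CotangentBundle E M)) x) :
    MDifferentiableAt 𝓘(ℝ, E) (𝓘(ℝ, E).prod 𝓘(ℝ, E))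
      (fun y ↦ (⟨y, P.sharp y (α y)⟩ : TotalSpace E (TangentSpace 𝓘(ℝ, E) : M → Type _))) x :=
  MDifferentiableAt.clm_bundle_apply (F₁ := E →L[ℝ] ℝ) (F₂ := E)
    (E₁ := (fun x : M ↦ CotangentSpace E x)) (E₂ := (TangentSpace 𝓘(ℝ, E) : M → Type _))
    ((P.contMDiff_sharp.contMDiffAt).mdifferentiableAt (by simp)) hα

lemma mvfderiv_const_smul' {f : M → ℝ} {x : M} (hf : MDifferentiableAt 𝓘(ℝ, E) 𝓘(ℝ, ℝ) f x)
    (r : ℝ) : mvfderiv 𝓘(ℝ, E) (fun y ↦ r * f y) x = r • mvfderiv 𝓘(ℝ, E) f x := by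
  have := mvfderiv_smul (I := 𝓘(ℝ, E)) (a := fun _ : M ↦ r) mdifferentiableAt_const hf
  rw [mvfderiv_const] at this
  simp only [ContinuousLinearMap.zero_smulRight, add_zero] at this
  exact this

lemma torsionForm_smul_smul (P : PoissonStructure E M) (nabla : AffineConnection E M) {x : M}
    {α β : ∀ x : M, CotangentSpace E x} {Y : ∀ x : M, TangentSpace 𝓘(ℝ, E) x}
    (hα : MDifferentiableAt 𝓘(ℝ, E) (𝓘(ℝ, E).prod 𝓘(ℝ, E →L[ℝ] ℝ))
      (fun y ↦ (⟨y, α y⟩ : CotangentBundle E M)) x)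
    (hβ : MDifferentiableAt 𝓘(ℝ, E) (𝓘(ℝ, E).prod 𝓘(ℝ, E →L[ℝ] ℝ))
      (fun y ↦ (⟨y, β y⟩ : CotangentBundle E M)) x)
    (hY : MDifferentiableAt 𝓘(ℝ, E) (𝓘(ℝ, E).prod 𝓘(ℝ, E))
      (fun y ↦ (⟨y, Y y⟩ : TotalSpace E (TangentSpace 𝓘(ℝ, E) : M → Type _))) x)
    (r s : ℝ) :
    P.torsionForm nabla (r • α) (s • β) Y x = r * s * P.torsionForm nabla α β Y x := by
  have e1 : ∀ (r : ℝ) (α : ∀ x : M, CotangentSpace E x),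
      (fun y ↦ P.sharp y ((r • α) y)) = r • (fun y ↦ P.sharp y (α y)) := by
    intro r α; funext y; simp
  have e2 := mvfderiv_const_smul' (mdiff_pair hα hY) r
  have e3 := mvfderiv_const_smul' (mdiff_pair hβ hY) s
  have e4 := mvfderiv_const_smul' (mdiff_pair hβ (mdiff_sharp P hα)) (r * s)
  have e5 := VectorField.mlieBracket_const_smul_left (W := Y) (c := r) (mdiff_sharp P hα)
  have e6 := VectorField.mlieBracket_const_smul_left (W := Y) (c := s) (mdiff_sharp P hβ)
  simp only [PoissonStructure.torsionForm, PoissonStructure.koszulBracket, covDerivForm,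
    lieDerivForm]
  rw [e1, e1, e5, e6]
  simp only [Pi.smul_apply, _root_.smul_apply, map_smul, smul_eq_mul] at e2 e3 e4 ⊢
  rw [e2, e3]
  simp only [← mul_assoc]
  rw [e4]
  simp only [_root_.smul_apply, smul_eq_mul]
  ring

lemma torsionForm_self (P : PoissonStructure E M) (nabla : AffineConnection E M) {x : M}
    (α : ∀ x : M, CotangentSpace E x) (Y : ∀ x : M, TangentSpace 𝓘(ℝ, E) x) :
    P.torsionForm nabla α α Y x = 0 := by
  have h : (fun y ↦ (α y (P.sharp y (α y)) : ℝ)) = fun _ ↦ (0 : ℝ) := by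
    funext y
    have := P.skew y (α y) (α y)
    change (α y (P.sharp y (α y)) : ℝ) = - (α y (P.sharp y (α y)) : ℝ) at this
    linarith
  simp only [PoissonStructure.torsionForm, PoissonStructure.koszulBracket, covDerivForm,
    lieDerivForm]
  rw [h, mvfderiv_const]
  simp

lemma torsion_smul_smul (P : PoissonStructure E M) (nabla : AffineConnection E M) {x : M}
    (α β : CotangentSpace E x) (Y : SmoothVectorField E M) (r s : ℝ) :
    P.torsion nabla (r • α) (s • β) Y = r * s * P.torsion nabla α β Y := by
  simp only [PoissonStructure.torsion]
  rw [torsionForm_congr P nabla (extend_smul x r α) (extend_smul x s β)]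
  exact torsionForm_smul_smul P nabla (FiberBundle.mdifferentiableAt_extend ..)
    (FiberBundle.mdifferentiableAt_extend ..) (Y.contMDiff.contMDiffAt.mdifferentiableAt (by simp)) r s

lemma torsion_smul_self (P : PoissonStructure E M) (nabla : AffineConnection E M) {x : M}
    (α : CotangentSpace E x) (Y : SmoothVectorField E M) (r s : ℝ) :
    P.torsion nabla (r • α) (s • α) Y = 0 := by
  rw [torsion_smul_smul, PoissonStructure.torsion, torsionForm_self, mul_zero]

/-! ### Regularity of rescaled families of covectors -/

/-- Fibrewise multiplication by scalars on `T*M`. -/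
def scale (r : ℝ) (v : CotangentBundle E M) : CotangentBundle E M := ⟨v.proj, r • v.2⟩

section regularity

variable {F : Type*} [NormedAddCommGroup F] [NormedSpace ℝ F]

lemma contMDiffWithinAt_scale {s : Set F} {z : F} {r : F → ℝ} {g : F → CotangentBundle E M}
    (hr : ContDiffWithinAt ℝ 1 r s z)
    (hg : ContMDiffWithinAt 𝓘(ℝ, F) (𝓘(ℝ, E).prod 𝓘(ℝ, E →L[ℝ] ℝ)) 1 g s z) :
    ContMDiffWithinAt 𝓘(ℝ, F) (𝓘(ℝ, E).prod 𝓘(ℝ, E →L[ℝ] ℝ)) 1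
      (fun w ↦ scale (r w) (g w)) s z := by
  rw [contMDiffWithinAt_totalSpace] at hg ⊢
  refine ⟨hg.1, ?_⟩
  have h := hr.contMDiffWithinAt.smul hg.2
  set e := trivializationAt (E →L[ℝ] ℝ) (fun x : M ↦ CotangentSpace E x) (g z).proj
  have hz : (g z).proj ∈ e.baseSet := FiberBundle.mem_baseSet_trivializationAt' _
  have hlin : ∀ w, (g w).proj ∈ e.baseSet → (e (scale (r w) (g w))).2 = r w • (e (g w)).2 :=
    fun w hw ↦ (e.linear ℝ hw).map_smul (r w) (g w).2
  refine h.congr_of_eventuallyEq ?_ (hlin z hz)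
  have := hg.1.continuousWithinAt.preimage_mem_nhdsWithin (e.open_baseSet.mem_nhds hz)
  filter_upwards [this] with w hw
  exact hlin w hw

lemma contDiffWithinAt_pair {s : Set F} {z : F} {g : F → CotangentBundle E M}
    (hg : ContMDiffWithinAt 𝓘(ℝ, F) (𝓘(ℝ, E).prod 𝓘(ℝ, E →L[ℝ] ℝ)) 1 g s z)
    (Y : SmoothVectorField E M) :
    ContDiffWithinAt ℝ 1 (fun w ↦ ((g w).2 (Y (g w).proj) : ℝ)) s z := by
  have hb : ContMDiffWithinAt 𝓘(ℝ, F) 𝓘(ℝ, E) 1 (fun w ↦ (g w).proj) s z :=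
    (contMDiffWithinAt_totalSpace.1 hg).1
  have hY : ContMDiffWithinAt 𝓘(ℝ, F) (𝓘(ℝ, E).prod 𝓘(ℝ, E)) 1
      (fun w ↦ (⟨(g w).proj, Y (g w).proj⟩ : TotalSpace E (TangentSpace 𝓘(ℝ, E) : M → Type _)))
      s z :=
    ((Y.contMDiff.of_le (by exact_mod_cast le_top)).contMDiffAt).comp_contMDiffWithinAt z hb
  have := ContMDiffWithinAt.clm_bundle_apply (F₁ := E) (F₂ := ℝ)
    (E₁ := (TangentSpace 𝓘(ℝ, E) : M → Type _)) (E₂ := Bundle.Trivial M ℝ)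
    (b := fun w ↦ (g w).proj) (ϕ := fun w ↦ (g w).2) hg hY
  have h2 := (contMDiffWithinAt_totalSpace.1 this).2
  exact (contMDiffWithinAt_iff_contDiffWithinAt.1 h2)

end regularity

/-! ### Reparametrization of families -/

/-- A triple of a point of `M` and two covectors at that point. -/
abbrev CovectorPair (E M : Type*) [NormedAddCommGroup E] [NormedSpace ℝ E]
    [TopologicalSpace M] [ChartedSpace E M] : Type _ :=
  (x : M) × (CotangentSpace E x × CotangentSpace E x)

/-- The first covector of a pair, as a point of `T*M`. -/
def CovectorPair.toBundle (c : CovectorPair E M) : CotangentBundle E M := ⟨c.1, c.2.1⟩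

/-- The local conditions on a family `c = (γ, a, b)` in the definition of cotangent homotopies. -/
structure FamilyAt (P : PoissonStructure E M) (nabla : AffineConnection E M)
    (c : ℝ → ℝ → CovectorPair E M) (ε t : ℝ) : Prop where
  smooth : ContMDiffWithinAt 𝓘(ℝ, ℝ × ℝ) (𝓘(ℝ, E).prod 𝓘(ℝ, E →L[ℝ] ℝ)) 1
    (fun z : ℝ × ℝ ↦ (c z.1 z.2).toBundle) (unitInterval ×ˢ unitInterval) (ε, t)
  vel : HasMFDerivWithinAt 𝓘(ℝ, ℝ) 𝓘(ℝ, E) (fun s ↦ (c ε s).1) unitInterval t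
      ((1 : ℝ →L[ℝ] ℝ).smulRight (P.sharp (c ε t).1 (c ε t).2.1))
  eqn : P.VariationEquationAt nabla (fun ε t ↦ (c ε t).1) (fun ε t ↦ (c ε t).2.1)
    (fun ε t ↦ (c ε t).2.2) ε t

lemma velocity_eq {γ : ℝ → M} {t : ℝ} (ht : t ∈ unitInterval) {v : TangentSpace 𝓘(ℝ, E) (γ t)}
    (h : HasMFDerivWithinAt 𝓘(ℝ, ℝ) 𝓘(ℝ, E) γ unitInterval t ((1 : ℝ →L[ℝ] ℝ).smulRight v)) :
    velocity (E := E) γ t = v := by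
  have hu : UniqueMDiffWithinAt 𝓘(ℝ, ℝ) unitInterval t :=
    ((uniqueDiffOn_Icc_zero_one).uniqueDiffWithinAt ht).uniqueMDiffWithinAt
  rw [velocity, h.mfderivWithin hu]
  change (1 : ℝ) • v = v
  rw [one_smul]

lemma variationEquationAt_of {P : PoissonStructure E M} {nabla : AffineConnection E M}
    {c : ℝ → ℝ → CovectorPair E M} {ε t : ℝ} (hε : ε ∈ unitInterval) (ht : t ∈ unitInterval)
    {v w : TangentSpace 𝓘(ℝ, E) (c ε t).1}
    (hv : HasMFDerivWithinAt 𝓘(ℝ, ℝ) 𝓘(ℝ, E) (fun s ↦ (c ε s).1) unitInterval t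
      ((1 : ℝ →L[ℝ] ℝ).smulRight v))
    (hw : HasMFDerivWithinAt 𝓘(ℝ, ℝ) 𝓘(ℝ, E) (fun e ↦ (c e t).1) unitInterval ε
      ((1 : ℝ →L[ℝ] ℝ).smulRight w))
    (h : ∀ Y : SmoothVectorField E M, ∃ f g : ℝ,
      HasDerivWithinAt (fun s ↦ ((c ε s).2.2 (Y (c ε s).1) : ℝ)) f unitInterval t ∧
      HasDerivWithinAt (fun e ↦ ((c e t).2.1 (Y (c e t).1) : ℝ)) g unitInterval ε ∧
      (f - (c ε t).2.2 (nabla Y (c ε t).1 v)) - (g - (c ε t).2.1 (nabla Y (c ε t).1 w))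
        = P.torsion nabla (c ε t).2.1 (c ε t).2.2 Y) :
    P.VariationEquationAt nabla (fun ε t ↦ (c ε t).1) (fun ε t ↦ (c ε t).2.1)
      (fun ε t ↦ (c ε t).2.2) ε t := by
  intro Y
  obtain ⟨f, g, hf, hg, e⟩ := h Y
  refine ⟨hf.differentiableWithinAt, ?_⟩
  rw [← e]
  simp only [covDerivAlong]
  rw [velocity_eq ht hv, velocity_eq hε hw,
    hf.derivWithin (uniqueDiffOn_Icc_zero_one.uniqueDiffWithinAt ht),
    hg.derivWithin (uniqueDiffOn_Icc_zero_one.uniqueDiffWithinAt hε)]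

lemma contMDiffWithinAt_slice_left {g : ℝ → ℝ → CotangentBundle E M} {ε t : ℝ}
    (ht : t ∈ unitInterval)
    (h : ContMDiffWithinAt 𝓘(ℝ, ℝ × ℝ) (𝓘(ℝ, E).prod 𝓘(ℝ, E →L[ℝ] ℝ)) 1
      (fun z : ℝ × ℝ ↦ g z.1 z.2) (unitInterval ×ˢ unitInterval) (ε, t)) :
    ContMDiffWithinAt 𝓘(ℝ, ℝ) (𝓘(ℝ, E).prod 𝓘(ℝ, E →L[ℝ] ℝ)) 1 (fun e ↦ g e t)
      unitInterval ε :=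
  ContMDiffWithinAt.comp (I' := 𝓘(ℝ, ℝ × ℝ)) (g := fun z : ℝ × ℝ ↦ g z.1 z.2)
    (f := fun e : ℝ ↦ (e, t)) ε h
    ((contDiff_id.prodMk contDiff_const).contMDiff.contMDiffAt.contMDiffWithinAt)
    (fun _ he ↦ ⟨he, ht⟩)

lemma contMDiffWithinAt_slice_right {g : ℝ → ℝ → CotangentBundle E M} {ε t : ℝ}
    (hε : ε ∈ unitInterval)
    (h : ContMDiffWithinAt 𝓘(ℝ, ℝ × ℝ) (𝓘(ℝ, E).prod 𝓘(ℝ, E →L[ℝ] ℝ)) 1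
      (fun z : ℝ × ℝ ↦ g z.1 z.2) (unitInterval ×ˢ unitInterval) (ε, t)) :
    ContMDiffWithinAt 𝓘(ℝ, ℝ) (𝓘(ℝ, E).prod 𝓘(ℝ, E →L[ℝ] ℝ)) 1 (fun s ↦ g ε s)
      unitInterval t :=
  ContMDiffWithinAt.comp (I' := 𝓘(ℝ, ℝ × ℝ)) (g := fun z : ℝ × ℝ ↦ g z.1 z.2)
    (f := fun s : ℝ ↦ (ε, s)) t h
    ((contDiff_const.prodMk contDiff_id).contMDiff.contMDiffAt.contMDiffWithinAt)
    (fun _ hs ↦ ⟨hε, hs⟩)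

lemma hasMFDerivWithinAt_of_smooth {g : ℝ → CotangentBundle E M} {s : Set ℝ} {t : ℝ}
    (h : ContMDiffWithinAt 𝓘(ℝ, ℝ) (𝓘(ℝ, E).prod 𝓘(ℝ, E →L[ℝ] ℝ)) 1 g s t) :
    ∃ w : TangentSpace 𝓘(ℝ, E) (g t).proj,
      HasMFDerivWithinAt 𝓘(ℝ, ℝ) 𝓘(ℝ, E) (fun e ↦ (g e).proj) s t
        ((1 : ℝ →L[ℝ] ℝ).smulRight w) := by
  have hb : ContMDiffWithinAt 𝓘(ℝ, ℝ) 𝓘(ℝ, E) 1 (fun e ↦ (g e).proj) s t :=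
    (contMDiffWithinAt_totalSpace.1 h).1
  have hd := (hb.mdifferentiableWithinAt (by simp)).hasMFDerivWithinAt
  refine ⟨mfderivWithin 𝓘(ℝ, ℝ) 𝓘(ℝ, E) (fun e ↦ (g e).proj) s t (1 : ℝ), ?_⟩
  have e : ((1 : ℝ →L[ℝ] ℝ).smulRight
      (mfderivWithin 𝓘(ℝ, ℝ) 𝓘(ℝ, E) (fun e ↦ (g e).proj) s t (1 : ℝ)) : ℝ →L[ℝ] E)
      = mfderivWithin 𝓘(ℝ, ℝ) 𝓘(ℝ, E) (fun e ↦ (g e).proj) s t :=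
    ContinuousLinearMap.ext_ring (one_smul ℝ _)
  rw [← e] at hd
  exact hd

lemma FamilyAt.exists_derivs {P : PoissonStructure E M} {nabla : AffineConnection E M}
    {c : ℝ → ℝ → CovectorPair E M} {ε t : ℝ} (h : FamilyAt P nabla c ε t)
    (hε : ε ∈ unitInterval) (ht : t ∈ unitInterval) :
    ∃ w : TangentSpace 𝓘(ℝ, E) (c ε t).1,
      HasMFDerivWithinAt 𝓘(ℝ, ℝ) 𝓘(ℝ, E) (fun e ↦ (c e t).1) unitInterval ε
        ((1 : ℝ →L[ℝ] ℝ).smulRight w) ∧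
      ∀ Y : SmoothVectorField E M, ∃ f g : ℝ,
        HasDerivWithinAt (fun s ↦ ((c ε s).2.2 (Y (c ε s).1) : ℝ)) f unitInterval t ∧
        HasDerivWithinAt (fun e ↦ ((c e t).2.1 (Y (c e t).1) : ℝ)) g unitInterval ε ∧
        (f - (c ε t).2.2 (nabla Y (c ε t).1 (P.sharp (c ε t).1 (c ε t).2.1)))
          - (g - (c ε t).2.1 (nabla Y (c ε t).1 w))
          = P.torsion nabla (c ε t).2.1 (c ε t).2.2 Y := by
  have hs := contMDiffWithinAt_slice_left (g := fun e s ↦ (c e s).toBundle) ht h.smooth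
  obtain ⟨w, hw⟩ : ∃ w : TangentSpace 𝓘(ℝ, E) (c ε t).1,
      HasMFDerivWithinAt 𝓘(ℝ, ℝ) 𝓘(ℝ, E) (fun e ↦ (c e t).1) unitInterval ε
        ((1 : ℝ →L[ℝ] ℝ).smulRight w) := hasMFDerivWithinAt_of_smooth hs
  refine ⟨w, hw, fun Y ↦ ?_⟩
  obtain ⟨hb, e⟩ := h.eqn Y
  have ha : DifferentiableWithinAt ℝ (fun e ↦ ((c e t).2.1 (Y (c e t).1) : ℝ)) unitInterval ε :=
    (contDiffWithinAt_pair hs Y).differentiableWithinAt (by simp)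
  refine ⟨_, _, hb.hasDerivWithinAt, ha.hasDerivWithinAt, ?_⟩
  rw [← e]
  simp only [covDerivAlong]
  rw [velocity_eq ht h.vel, velocity_eq hε hw]

lemma FamilyAt.congr {P : PoissonStructure E M} {nabla : AffineConnection E M}
    {c c' : ℝ → ℝ → CovectorPair E M} {ε t : ℝ} (h : FamilyAt P nabla c ε t)
    (hε : ε ∈ unitInterval) (ht : t ∈ unitInterval)
    (hc : ∀ᶠ z : ℝ × ℝ in 𝓝[unitInterval ×ˢ unitInterval] (ε, t), c' z.1 z.2 = c z.1 z.2) :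
    FamilyAt P nabla c' ε t := by
  obtain ⟨w, hw, hY⟩ := h.exists_derivs hε ht
  have h0 : c' ε t = c ε t := hc.self_of_nhdsWithin ⟨hε, ht⟩
  have hr : ∀ᶠ s in 𝓝[unitInterval] t, c' ε s = c ε s := by
    have : Filter.Tendsto (fun s : ℝ ↦ (ε, s)) (𝓝[unitInterval] t)
        (𝓝[unitInterval ×ˢ unitInterval] (ε, t)) :=
      (Continuous.continuousWithinAt (by fun_prop)).tendsto_nhdsWithin (fun _ hs ↦ ⟨hε, hs⟩)
    exact this.eventually hc
  have hl : ∀ᶠ e in 𝓝[unitInterval] ε, c' e t = c e t := by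
    have : Filter.Tendsto (fun e : ℝ ↦ (e, t)) (𝓝[unitInterval] ε)
        (𝓝[unitInterval ×ˢ unitInterval] (ε, t)) :=
      (Continuous.continuousWithinAt (by fun_prop)).tendsto_nhdsWithin (fun _ hs ↦ ⟨hs, ht⟩)
    exact this.eventually hc
  have hv' : HasMFDerivWithinAt 𝓘(ℝ, ℝ) 𝓘(ℝ, E) (fun s ↦ (c' ε s).1) unitInterval t
      ((1 : ℝ →L[ℝ] ℝ).smulRight (P.sharp (c' ε t).1 (c' ε t).2.1)) := by
    rw [h0]
    refine h.vel.congr_of_eventuallyEq ?_ (by rw [h0])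
    filter_upwards [hr] with s hs
    rw [hs]
  refine ⟨?_, hv', ?_⟩
  · refine h.smooth.congr_of_eventuallyEq ?_ (by rw [h0])
    filter_upwards [hc] with z hz
    rw [hz]
  · obtain ⟨w', hw'⟩ : ∃ w' : TangentSpace 𝓘(ℝ, E) (c' ε t).1, HEq w' w := by
      rw [h0]; exact ⟨w, HEq.rfl⟩
    refine variationEquationAt_of hε ht (w := w') hv' ?_ fun Y ↦ ?_
    · refine HasMFDerivWithinAt.congr_of_eventuallyEq (f := fun e ↦ (c e t).1) ?_ ?_ (by rw [h0])
      · revert w'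
        rw [h0]
        intro w' hw'
        rw [eq_of_heq hw']
        exact hw
      · filter_upwards [hl] with s hs
        rw [hs]
    · obtain ⟨f, g, hf, hg, e⟩ := hY Y
      refine ⟨f, g, ?_, ?_, ?_⟩
      · refine hf.congr_of_eventuallyEq ?_ (by rw [h0])
        filter_upwards [hr] with s hs
        rw [hs]
      · refine hg.congr_of_eventuallyEq ?_ (by rw [h0])
        filter_upwards [hl] with s hs
        rw [hs]
      · revert w'
        rw [h0]
        intro w' hw'
        rw [eq_of_heq hw']
        exact e

lemma sharp_smul (P : PoissonStructure E M) {x : M} (r : ℝ) (α : CotangentSpace E x) :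
    P.sharp x (r • α) = r • P.sharp x α := map_smul (P.sharp x) r α

lemma pair_smul {x : M} (r s : ℝ) (α : CotangentSpace E x)
    (L : TangentSpace 𝓘(ℝ, E) x →L[ℝ] TangentSpace 𝓘(ℝ, E) x) (v : TangentSpace 𝓘(ℝ, E) x) :
    ((r • α) (L (s • v)) : ℝ) = r * (s * (α (L v) : ℝ)) := by
  rw [map_smul]
  change r * (α (s • L v) : ℝ) = _
  rw [map_smul]
  rfl

lemma hasMFDerivWithinAt_comp_real {γ : ℝ → M} {q : ℝ → ℝ} {q' t : ℝ} {s s' : Set ℝ}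
    {v : TangentSpace 𝓘(ℝ, E) (γ (q t))}
    (h : HasMFDerivWithinAt 𝓘(ℝ, ℝ) 𝓘(ℝ, E) γ s (q t) ((1 : ℝ →L[ℝ] ℝ).smulRight v))
    (hq : HasDerivAt q q' t) (hm : MapsTo q s' s) :
    HasMFDerivWithinAt 𝓘(ℝ, ℝ) 𝓘(ℝ, E) (fun r ↦ γ (q r)) s' t
      ((1 : ℝ →L[ℝ] ℝ).smulRight (q' • v)) := by
  have h1 : HasMFDerivWithinAt 𝓘(ℝ, ℝ) 𝓘(ℝ, ℝ) q s' t
      ((1 : ℝ →L[ℝ] ℝ).smulRight q' : ℝ →L[ℝ] ℝ) :=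
    hq.hasDerivWithinAt.hasFDerivWithinAt.hasMFDerivWithinAt
  have h2 := HasMFDerivWithinAt.comp (I' := 𝓘(ℝ, ℝ)) t h h1 hm
  have e : (((1 : ℝ →L[ℝ] ℝ).smulRight v : ℝ →L[ℝ] E).comp
      ((1 : ℝ →L[ℝ] ℝ).smulRight q' : ℝ →L[ℝ] ℝ)) = ((1 : ℝ →L[ℝ] ℝ).smulRight (q' • v)) := by
    apply ContinuousLinearMap.ext_ring
    change ((1 : ℝ) • q') • (v : E) = (1 : ℝ) • (q' • v)
    rw [one_smul, one_smul]
  rw [← e]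
  exact h2

/-- Rescale the two covectors of a pair. -/
def CovectorPair.rescale (r s : ℝ) (c : CovectorPair E M) : CovectorPair E M :=
  ⟨c.1, r • c.2.1, s • c.2.2⟩

lemma FamilyAt.rescale {P : PoissonStructure E M} {nabla : AffineConnection E M}
    {c : ℝ → ℝ → CovectorPair E M} {p q : ℝ → ℝ} {ε t : ℝ}
    (hp : ContDiff ℝ 2 p) (hq : ContDiff ℝ 2 q)
    (hpm : MapsTo p unitInterval unitInterval) (hqm : MapsTo q unitInterval unitInterval)
    (hε : ε ∈ unitInterval) (ht : t ∈ unitInterval)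
    (h : FamilyAt P nabla c (p ε) (q t)) :
    FamilyAt P nabla (fun ε t ↦ (c (p ε) (q t)).rescale (deriv q t) (deriv p ε)) ε t := by
  obtain ⟨w, hw, hY⟩ := h.exists_derivs (hpm hε) (hqm ht)
  have hp' : HasDerivAt p (deriv p ε) ε := (hp.differentiable (by simp)).differentiableAt.hasDerivAt
  have hq' : HasDerivAt q (deriv q t) t := (hq.differentiable (by simp)).differentiableAt.hasDerivAt
  have hv := hasMFDerivWithinAt_comp_real h.vel hq' hqm
  have hw' := hasMFDerivWithinAt_comp_real hw hp' hpm
  have hdq : ContDiff ℝ 1 (deriv q) := ContDiff.deriv' (n := 1) (by exact hq)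
  refine ⟨?_, ?_, ?_⟩
  · have h1 : ContMDiffWithinAt 𝓘(ℝ, ℝ × ℝ) (𝓘(ℝ, E).prod 𝓘(ℝ, E →L[ℝ] ℝ)) 1
        (fun z : ℝ × ℝ ↦ (c (p z.1) (q z.2)).toBundle) (unitInterval ×ˢ unitInterval) (ε, t) :=
      ContMDiffWithinAt.comp (I' := 𝓘(ℝ, ℝ × ℝ)) (g := fun z : ℝ × ℝ ↦ (c z.1 z.2).toBundle)
        (f := fun z : ℝ × ℝ ↦ (p z.1, q z.2)) (ε, t) h.smooth
        ((((hp.of_le (by norm_num)).comp contDiff_fst).prodMk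
          ((hq.of_le (by norm_num)).comp contDiff_snd)).contMDiff.contMDiffAt.contMDiffWithinAt)
        (fun z hz ↦ ⟨hpm hz.1, hqm hz.2⟩)
    exact contMDiffWithinAt_scale (r := fun z : ℝ × ℝ ↦ deriv q z.2)
      (hdq.comp contDiff_snd).contDiffAt.contDiffWithinAt h1
  · rw [← sharp_smul] at hv
    exact hv
  · refine variationEquationAt_of hε ht (v := deriv q t • P.sharp (c (p ε) (q t)).1
      (c (p ε) (q t)).2.1) (w := deriv p ε • w) hv hw' fun Y ↦ ?_
    obtain ⟨f, g, hf, hg, e⟩ := hY Y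
    have hf' := (hf.comp t hq'.hasDerivWithinAt hqm).const_mul (deriv p ε)
    have hg' := (hg.comp ε hp'.hasDerivWithinAt hpm).const_mul (deriv q t)
    refine ⟨_, _, hf', hg', ?_⟩
    refine Eq.trans ?_ (torsion_smul_smul P nabla _ _ Y _ _).symm
    refine Eq.trans (congrArg₂ (· - ·) (congrArg₂ (· - ·) rfl (pair_smul _ _ _ _ _))
      (congrArg₂ (· - ·) rfl (pair_smul _ _ _ _ _))) ?_
    refine Eq.trans ?_ (congrArg (fun r ↦ deriv q t * deriv p ε * r) e)
    simp only [CovectorPair.rescale]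
    ring

/-- The local conditions on a path in `T*M` to be a cotangent path on the set `s`. -/
structure PathAt (P : PoissonStructure E M) (s : Set ℝ) (a : ℝ → CotangentBundle E M) (t : ℝ) :
    Prop where
  smooth : ContMDiffWithinAt 𝓘(ℝ, ℝ) (𝓘(ℝ, E).prod 𝓘(ℝ, E →L[ℝ] ℝ)) 1 a s t
  vel : HasMFDerivWithinAt 𝓘(ℝ, ℝ) 𝓘(ℝ, E) (fun s ↦ (a s).proj) s t
    ((1 : ℝ →L[ℝ] ℝ).smulRight (P.sharp (a t).proj (a t).2))

/-- The reparametrization `t ↦ q'(t) a(q(t))` of a path in `T*M`. -/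
def reparam (q : ℝ → ℝ) (a : ℝ → CotangentBundle E M) (t : ℝ) : CotangentBundle E M :=
  scale (deriv q t) (a (q t))

lemma PathAt.reparam {P : PoissonStructure E M} {a : ℝ → CotangentBundle E M} {q : ℝ → ℝ}
    {s s' : Set ℝ} {t : ℝ} (hq : ContDiff ℝ 2 q) (hm : MapsTo q s' s) (h : PathAt P s a (q t)) :
    PathAt P s' (reparam q a) t := by
  have hq' : HasDerivAt q (deriv q t) t := (hq.differentiable (by simp)).differentiableAt.hasDerivAt
  have hdq : ContDiff ℝ 1 (deriv q) := ContDiff.deriv' (n := 1) (by exact hq)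
  refine ⟨?_, ?_⟩
  · refine contMDiffWithinAt_scale hdq.contDiffAt.contDiffWithinAt ?_
    exact ContMDiffWithinAt.comp (I' := 𝓘(ℝ, ℝ)) (g := a) t h.smooth
      (hq.of_le (by norm_num)).contMDiff.contMDiffAt.contMDiffWithinAt hm
  · have := hasMFDerivWithinAt_comp_real h.vel hq' hm
    rw [← sharp_smul] at this
    exact this

lemma PathAt.congr {P : PoissonStructure E M} {a a' : ℝ → CotangentBundle E M}
    {s : Set ℝ} {t : ℝ} (h : PathAt P s a t) (ht : t ∈ s) (hc : ∀ᶠ r in 𝓝[s] t, a' r = a r) :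
    PathAt P s a' t := by
  have h0 := hc.self_of_nhdsWithin ht
  refine ⟨h.smooth.congr_of_eventuallyEq hc h0, ?_⟩
  rw [h0]
  refine h.vel.congr_of_eventuallyEq ?_ (by rw [h0])
  filter_upwards [hc] with r hr
  rw [hr]

/-- The family obtained from one path by reparametrizations that interpolate between `q₀` and
`q₁`. -/
def sweep (q₀ q₁ : ℝ → ℝ) (a : ℝ → CotangentBundle E M) (ε t : ℝ) : CovectorPair E M :=
  ⟨(a ((1 - ε) * q₀ t + ε * q₁ t)).proj,
    ((1 - ε) * deriv q₀ t + ε * deriv q₁ t) • (a ((1 - ε) * q₀ t + ε * q₁ t)).2,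
    (q₁ t - q₀ t) • (a ((1 - ε) * q₀ t + ε * q₁ t)).2⟩

lemma familyAt_sweep (P : PoissonStructure E M) (nabla : AffineConnection E M)
    {a : ℝ → CotangentBundle E M} {q₀ q₁ : ℝ → ℝ} {s : Set ℝ} {ε t : ℝ}
    (hs : Convex ℝ s) (h₀ : ContDiff ℝ 2 q₀) (h₁ : ContDiff ℝ 2 q₁)
    (hm₀ : MapsTo q₀ unitInterval s) (hm₁ : MapsTo q₁ unitInterval s)
    (hε : ε ∈ unitInterval) (ht : t ∈ unitInterval)
    (h : ∀ r ∈ s, PathAt P s a r) :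
    FamilyAt P nabla (sweep q₀ q₁ a) ε t := by
  have hm : ∀ e ∈ unitInterval, ∀ r ∈ unitInterval, (1 - e) * q₀ r + e * q₁ r ∈ s := by
    intro e he r hr
    exact hs (hm₀ hr) (hm₁ hr) (sub_nonneg.2 he.2) he.1 (by ring)
  have hP := h _ (hm ε hε t ht)
  have hd₀ : ContDiff ℝ 1 (deriv q₀) := ContDiff.deriv' (n := 1) (by exact h₀)
  have hd₁ : ContDiff ℝ 1 (deriv q₁) := ContDiff.deriv' (n := 1) (by exact h₁)
  have h₀' : HasDerivAt q₀ (deriv q₀ t) t :=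
    (h₀.differentiable (by simp)).differentiableAt.hasDerivAt
  have h₁' : HasDerivAt q₁ (deriv q₁ t) t :=
    (h₁.differentiable (by simp)).differentiableAt.hasDerivAt
  have dt : HasDerivAt (fun r ↦ (1 - ε) * q₀ r + ε * q₁ r)
      ((1 - ε) * deriv q₀ t + ε * deriv q₁ t) t := (h₀'.const_mul _).add (h₁'.const_mul _)
  have de : HasDerivAt (fun e ↦ (1 - e) * q₀ t + e * q₁ t) (q₁ t - q₀ t) ε := by
    have := (((hasDerivAt_id ε).const_sub 1).mul_const (q₀ t)).add
      ((hasDerivAt_id ε).mul_const (q₁ t))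
    refine this.congr_deriv ?_
    ring
  have hv := hasMFDerivWithinAt_comp_real (q := fun r ↦ (1 - ε) * q₀ r + ε * q₁ r) hP.vel dt
    (hm ε hε)
  have hw := hasMFDerivWithinAt_comp_real (q := fun e ↦ (1 - e) * q₀ t + e * q₁ t) hP.vel de
    (fun e he ↦ hm e he t ht)
  refine ⟨?_, ?_, ?_⟩
  · refine contMDiffWithinAt_scale
      (r := fun z : ℝ × ℝ ↦ (1 - z.1) * deriv q₀ z.2 + z.1 * deriv q₁ z.2)
      (g := fun z : ℝ × ℝ ↦ a ((1 - z.1) * q₀ z.2 + z.1 * q₁ z.2)) ?_ ?_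
    · exact (ContDiff.contDiffAt (by fun_prop)).contDiffWithinAt
    · have hc : ContDiff ℝ 1 (fun z : ℝ × ℝ ↦ (1 - z.1) * q₀ z.2 + z.1 * q₁ z.2) := by
        have := h₀.of_le (m := 1) (by norm_num)
        have := h₁.of_le (m := 1) (by norm_num)
        fun_prop
      exact ContMDiffWithinAt.comp (I' := 𝓘(ℝ, ℝ)) (g := a)
        (f := fun z : ℝ × ℝ ↦ (1 - z.1) * q₀ z.2 + z.1 * q₁ z.2) (ε, t) hP.smooth
        hc.contMDiff.contMDiffAt.contMDiffWithinAt (fun z hz ↦ hm z.1 hz.1 z.2 hz.2)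
  · rw [← sharp_smul] at hv
    exact hv
  · refine variationEquationAt_of hε ht hv hw fun Y ↦ ?_
    have hY : HasDerivWithinAt (fun r ↦ ((a r).2 (Y (a r).proj) : ℝ))
        (derivWithin (fun r ↦ ((a r).2 (Y (a r).proj) : ℝ)) s ((1 - ε) * q₀ t + ε * q₁ t)) s
        ((1 - ε) * q₀ t + ε * q₁ t) :=
      ((contDiffWithinAt_pair hP.smooth Y).differentiableWithinAt (by simp)).hasDerivWithinAt
    set y := derivWithin (fun r ↦ ((a r).2 (Y (a r).proj) : ℝ)) s ((1 - ε) * q₀ t + ε * q₁ t)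
    have hf := ((h₁'.sub h₀').hasDerivWithinAt (s := unitInterval)).mul
      (HasDerivWithinAt.comp (h := fun r ↦ (1 - ε) * q₀ r + ε * q₁ r) t hY dt.hasDerivWithinAt
        (hm ε hε))
    have dl : HasDerivAt (fun e ↦ (1 - e) * deriv q₀ t + e * deriv q₁ t)
        (deriv q₁ t - deriv q₀ t) ε := by
      have := (((hasDerivAt_id ε).const_sub 1).mul_const (deriv q₀ t)).add
        ((hasDerivAt_id ε).mul_const (deriv q₁ t))
      refine this.congr_deriv ?_
      ring
    have hg := (dl.hasDerivWithinAt (s := unitInterval)).mul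
      (HasDerivWithinAt.comp (h := fun e ↦ (1 - e) * q₀ t + e * q₁ t) ε hY de.hasDerivWithinAt
        (fun e he ↦ hm e he t ht))
    refine ⟨_, _, hf, hg, ?_⟩
    refine Eq.trans ?_ (torsion_smul_self P nabla _ Y _ _).symm
    refine Eq.trans (congrArg₂ (· - ·) (congrArg₂ (· - ·) rfl (pair_smul _ _ _ _ _))
      (congrArg₂ (· - ·) rfl (pair_smul _ _ _ _ _))) ?_
    simp only [Function.comp, Pi.sub_apply]
    ring

/-! ### Cutoff functions -/

/-- A smooth function on `ℝ` that is `0` on `(-∞, 1/3]` and `1` on `[2/3, ∞)`. -/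
def cutoff (s : ℝ) : ℝ := Real.smoothTransition (3 * s - 1)

/-- The cutoff function compressed to the first half of `[0, 1]`. -/
def firstHalf (s : ℝ) : ℝ := cutoff (2 * s)

/-- The cutoff function compressed to the second half of `[0, 1]`. -/
def secondHalf (s : ℝ) : ℝ := cutoff (2 * s - 1)

lemma contDiff_cutoff : ContDiff ℝ 2 cutoff :=
  (Real.smoothTransition.contDiff (n := 2)).comp (by fun_prop)

lemma contDiff_firstHalf : ContDiff ℝ 2 firstHalf := contDiff_cutoff.comp (by fun_prop)

lemma contDiff_secondHalf : ContDiff ℝ 2 secondHalf := contDiff_cutoff.comp (by fun_prop)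

lemma cutoff_mem (s : ℝ) : cutoff s ∈ unitInterval :=
  ⟨Real.smoothTransition.nonneg _, Real.smoothTransition.le_one _⟩

lemma firstHalf_mem (s : ℝ) : firstHalf s ∈ unitInterval := cutoff_mem _

lemma secondHalf_mem (s : ℝ) : secondHalf s ∈ unitInterval := cutoff_mem _

lemma cutoff_eq_zero {s : ℝ} (h : s ≤ 1 / 3) : cutoff s = 0 :=
  Real.smoothTransition.zero_of_nonpos (by linarith)

lemma cutoff_eq_one {s : ℝ} (h : 2 / 3 ≤ s) : cutoff s = 1 :=
  Real.smoothTransition.one_of_one_le (by linarith)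

lemma deriv_cutoff_of_le {s : ℝ} (h : s ≤ 1 / 3) : deriv cutoff s = 0 := by
  apply IsLocalMin.deriv_eq_zero
  filter_upwards with r
  rw [cutoff_eq_zero h]
  exact (cutoff_mem r).1

lemma deriv_cutoff_of_ge {s : ℝ} (h : 2 / 3 ≤ s) : deriv cutoff s = 0 := by
  apply IsLocalMax.deriv_eq_zero
  filter_upwards with r
  rw [cutoff_eq_one h]
  exact (cutoff_mem r).2

lemma hasDerivAt_cutoff (s : ℝ) : HasDerivAt cutoff (deriv cutoff s) s :=
  (contDiff_cutoff.differentiable (by simp)).differentiableAt.hasDerivAt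

lemma hasDerivAt_firstHalf (s : ℝ) : HasDerivAt firstHalf (2 * deriv cutoff (2 * s)) s := by
  have := (hasDerivAt_cutoff (2 * s)).comp s ((hasDerivAt_id s).const_mul 2)
  refine this.congr_deriv ?_
  ring

lemma hasDerivAt_secondHalf (s : ℝ) :
    HasDerivAt secondHalf (2 * deriv cutoff (2 * s - 1)) s := by
  have := (hasDerivAt_cutoff (2 * s - 1)).comp s (((hasDerivAt_id s).const_mul 2).sub_const 1)
  refine this.congr_deriv ?_
  ring

lemma firstHalf_eq_one {s : ℝ} (h : 1 / 3 ≤ s) : firstHalf s = 1 := cutoff_eq_one (by linarith)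

lemma secondHalf_eq_zero {s : ℝ} (h : s ≤ 2 / 3) : secondHalf s = 0 :=
  cutoff_eq_zero (by linarith)

lemma deriv_firstHalf_eq_zero {s : ℝ} (h : 1 / 3 ≤ s) : deriv firstHalf s = 0 := by
  rw [(hasDerivAt_firstHalf s).deriv, deriv_cutoff_of_ge (by linarith), mul_zero]

lemma deriv_secondHalf_eq_zero {s : ℝ} (h : s ≤ 2 / 3) : deriv secondHalf s = 0 := by
  rw [(hasDerivAt_secondHalf s).deriv, deriv_cutoff_of_le (by linarith), mul_zero]

/-! ### Elementary identities -/

/-- The zero covector at `x`. -/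
def zeroCovector (x : M) : CotangentBundle E M := ⟨x, 0⟩

lemma scale_zero {v : CotangentBundle E M} {x : M} (h : v.proj = x) :
    scale 0 v = zeroCovector x := by
  subst h
  simp only [scale, zero_smul]
  rfl

lemma scale_zeroCovector (r : ℝ) (x : M) :
    scale r (zeroCovector x : CotangentBundle E M) = zeroCovector x :=
  congrArg (TotalSpace.mk (F := E →L[ℝ] ℝ) x) (smul_zero r : r • (0 : CotangentSpace E x) = 0)

lemma scale_one (v : CotangentBundle E M) : scale 1 v = v := by
  simp only [scale, one_smul]

lemma scale_scale (r s : ℝ) (v : CotangentBundle E M) :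
    scale r (scale s v) = scale (r * s) v :=
  congrArg (TotalSpace.mk (F := E →L[ℝ] ℝ) v.proj) (smul_smul r s v.2)

lemma smul_snd_eq_zero {c : CovectorPair E M} (h : c.2.2 = 0) (r : ℝ) : r • c.2.2 = 0 := by
  rw [h]
  exact smul_zero r

lemma end_rescale {c : CovectorPair E M} {x : M} (h : c.1 = x ∧ c.2.2 = 0) (r s : ℝ) :
    (c.rescale r s).1 = x ∧ (c.rescale r s).2.2 = 0 := ⟨h.1, smul_snd_eq_zero h.2 s⟩

lemma end_ite {c d : CovectorPair E M} {x : M} (p : Prop) [Decidable p] (h : c.1 = x ∧ c.2.2 = 0)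
    (h' : d.1 = x ∧ d.2.2 = 0) :
    (if p then c else d).1 = x ∧ (if p then c else d).2.2 = 0 := by
  by_cases hp : p
  · rw [if_pos hp]
    exact h
  · rw [if_neg hp]
    exact h'

lemma toBundle_rescale (r s : ℝ) (c : CovectorPair E M) :
    (c.rescale r s).toBundle = scale r c.toBundle := rfl

lemma toBundle_sweep (q₀ q₁ : ℝ → ℝ) (a : ℝ → CotangentBundle E M) (ε t : ℝ) :
    (sweep q₀ q₁ a ε t).toBundle = scale ((1 - ε) * deriv q₀ t + ε * deriv q₁ t)
      (a ((1 - ε) * q₀ t + ε * q₁ t)) := rfl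

lemma rescale_eq_of_toBundle_eq {c d : CovectorPair E M} (h : c.toBundle = d.toBundle) (r : ℝ) :
    c.rescale r 0 = d.rescale r 0 := by
  obtain ⟨x, α, β⟩ := c
  obtain ⟨y, α', β'⟩ := d
  simp only [CovectorPair.toBundle, TotalSpace.mk.injEq] at h
  obtain ⟨h1, h2⟩ := h
  subst h1
  rw [eq_of_heq h2]
  simp only [CovectorPair.rescale, zero_smul]

lemma rescale_eq_zero {c : CovectorPair E M} {x : M} (h : c.1 = x) (h' : c.2.2 = 0) (s : ℝ) :
    c.rescale 0 s = ⟨x, 0, 0⟩ := by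
  subst h
  simp only [CovectorPair.rescale, zero_smul, h', smul_zero]

lemma reparam_eq {q : ℝ → ℝ} {q' t : ℝ} (h : HasDerivAt q q' t) (a : ℝ → CotangentBundle E M) :
    reparam q a t = scale q' (a (q t)) := by
  rw [reparam, h.deriv]

/-! ### Cotangent homotopy is an equivalence relation -/

namespace CotangentPath

variable {P : PoissonStructure E M} {nabla : AffineConnection E M}

lemma pathAt (a : CotangentPath P) {t : ℝ} (ht : t ∈ unitInterval) : PathAt P unitInterval a t :=
  ⟨a.contMDiffOn t ht, a.hasMFDerivWithinAt t ht⟩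

lemma homotopic_of {a₀ a₁ : CotangentPath P} {c : ℝ → ℝ → CovectorPair E M} {x y : M}
    (hc : ∀ ε ∈ unitInterval, ∀ t ∈ unitInterval, FamilyAt P nabla c ε t)
    (h₀ : ∀ ε ∈ unitInterval, (c ε 0).1 = x ∧ (c ε 0).2.2 = 0)
    (h₁ : ∀ ε ∈ unitInterval, (c ε 1).1 = y ∧ (c ε 1).2.2 = 0)
    (hl : ∀ t ∈ unitInterval, (c 0 t).toBundle = a₀ t)
    (hr : ∀ t ∈ unitInterval, (c 1 t).toBundle = a₁ t) : a₀.Homotopic nabla a₁ := by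
  refine ⟨fun ε t ↦ (c ε t).toBundle, ⟨?_, ?_, ?_, ?_, fun ε t ↦ (c ε t).2.2, ?_, ?_, ?_⟩, ?_⟩
  · exact fun z hz ↦ (hc z.1 hz.1 z.2 hz.2).smooth
  · exact fun ε hε t ht ↦ (hc ε hε t ht).vel
  · exact fun ε hε ↦ (h₀ ε hε).1.trans (h₀ 0 unitInterval.zero_mem).1.symm
  · exact fun ε hε ↦ (h₁ ε hε).1.trans (h₁ 0 unitInterval.zero_mem).1.symm
  · exact fun ε hε t ht ↦ (hc ε hε t ht).eqn
  · exact fun ε hε ↦ (h₀ ε hε).2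
  · exact fun ε hε ↦ (h₁ ε hε).2
  · exact fun t ht ↦ ⟨hl t ht, hr t ht⟩

lemma Homotopic.exists_family {a₀ a₁ : CotangentPath P} (h : a₀.Homotopic nabla a₁) :
    ∃ c : ℝ → ℝ → CovectorPair E M,
      (∀ ε ∈ unitInterval, ∀ t ∈ unitInterval, FamilyAt P nabla c ε t) ∧
      (∀ ε ∈ unitInterval, (c ε 0).1 = (a₀ 0).proj ∧ (c ε 0).2.2 = 0) ∧
      (∀ ε ∈ unitInterval, (c ε 1).1 = (a₀ 1).proj ∧ (c ε 1).2.2 = 0) ∧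
      (∀ t ∈ unitInterval, (c 0 t).toBundle = a₀ t) ∧
      (∀ t ∈ unitInterval, (c 1 t).toBundle = a₁ t) := by
  obtain ⟨a, ⟨hs, hv, h0, h1, b, hb, hb0, hb1⟩, he⟩ := h
  refine ⟨fun ε t ↦ ⟨(a ε t).proj, (a ε t).2, b ε t⟩, fun ε hε t ht ↦ ⟨hs (ε, t) ⟨hε, ht⟩,
    hv ε hε t ht, hb ε hε t ht⟩, fun ε hε ↦ ⟨?_, hb0 ε hε⟩, fun ε hε ↦ ⟨?_, hb1 ε hε⟩,
    fun t ht ↦ (he t ht).1, fun t ht ↦ (he t ht).2⟩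
  · exact (h0 ε hε).trans (by rw [(he 0 unitInterval.zero_mem).1])
  · exact (h1 ε hε).trans (by rw [(he 1 unitInterval.one_mem).1])

/-- Two reparametrizations with the same end points of one path are homotopic. -/
lemma homotopic_of_reparam {a : ℝ → CotangentBundle E M} {s : Set ℝ} (hs : Convex ℝ s)
    (h : ∀ r ∈ s, PathAt P s a r) {q₀ q₁ : ℝ → ℝ} (hq₀ : ContDiff ℝ 2 q₀) (hq₁ : ContDiff ℝ 2 q₁)
    (hm₀ : MapsTo q₀ unitInterval s) (hm₁ : MapsTo q₁ unitInterval s)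
    (h0 : q₁ 0 = q₀ 0) (h1 : q₁ 1 = q₀ 1) {a₀ a₁ : CotangentPath P}
    (e₀ : ∀ t ∈ unitInterval, a₀ t = reparam q₀ a t)
    (e₁ : ∀ t ∈ unitInterval, a₁ t = reparam q₁ a t) : a₀.Homotopic nabla a₁ := by
  refine homotopic_of (c := sweep q₀ q₁ a) (x := (a (q₀ 0)).proj) (y := (a (q₀ 1)).proj)
    (fun ε hε t ht ↦ familyAt_sweep P nabla hs hq₀ hq₁ hm₀ hm₁ hε ht h) ?_ ?_ ?_ ?_
  · refine fun ε _ ↦ ⟨congrArg (fun r ↦ (a r).proj) (by rw [h0]; ring), ?_⟩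
    simp only [sweep, h0, sub_self]
    exact zero_smul ℝ _
  · refine fun ε _ ↦ ⟨congrArg (fun r ↦ (a r).proj) (by rw [h1]; ring), ?_⟩
    simp only [sweep, h1, sub_self]
    exact zero_smul ℝ _
  · intro t ht
    rw [e₀ t ht, toBundle_sweep, sub_zero, one_mul, zero_mul, add_zero, one_mul, zero_mul,
      add_zero, reparam]
  · intro t ht
    rw [e₁ t ht, toBundle_sweep, sub_self, one_mul, zero_mul, zero_add, one_mul, zero_mul,
      zero_add, reparam]

lemma Homotopic.refl (a : CotangentPath P) : a.Homotopic nabla a := by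
  refine homotopic_of_reparam (convex_Icc 0 1) (fun r hr ↦ a.pathAt hr) (q₀ := id) (q₁ := id)
    contDiff_id contDiff_id (mapsTo_id _) (mapsTo_id _) rfl rfl ?_ ?_ <;>
  · intro t _
    rw [reparam_eq (hasDerivAt_id t), scale_one]
    rfl

lemma Homotopic.symm {a₀ a₁ : CotangentPath P} (h : a₀.Homotopic nabla a₁) :
    a₁.Homotopic nabla a₀ := by
  obtain ⟨c, hc, h0, h1, hl, hr⟩ := h.exists_family
  have hm : MapsTo (fun s : ℝ ↦ 1 - s) unitInterval unitInterval := fun s hs ↦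
    ⟨sub_nonneg.2 hs.2, sub_le_self _ hs.1⟩
  refine homotopic_of (c := fun ε t ↦ (c (1 - ε) (id t)).rescale (deriv id t)
    (deriv (fun s : ℝ ↦ 1 - s) ε)) (x := (a₀ 0).proj) (y := (a₀ 1).proj)
    (fun ε hε t ht ↦ FamilyAt.rescale (by fun_prop) contDiff_id hm (mapsTo_id _) hε ht
      (hc _ (hm hε) t ht)) ?_ ?_ ?_ ?_
  · exact fun ε hε ↦ ⟨(h0 _ (hm hε)).1, smul_snd_eq_zero (h0 _ (hm hε)).2 _⟩
  · exact fun ε hε ↦ ⟨(h1 _ (hm hε)).1, smul_snd_eq_zero (h1 _ (hm hε)).2 _⟩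
  · intro t ht
    rw [← hr t ht, toBundle_rescale, sub_zero, deriv_id, scale_one, id]
  · intro t ht
    rw [← hl t ht, toBundle_rescale, sub_self, deriv_id, scale_one, id]

lemma Homotopic.trans {a₀ a₁ a₂ : CotangentPath P} (h : a₀.Homotopic nabla a₁)
    (h' : a₁.Homotopic nabla a₂) : a₀.Homotopic nabla a₂ := by
  obtain ⟨c, hc, h0, h1, hl, hr⟩ := h.exists_family
  obtain ⟨d, hd, k0, k1, kl, kr⟩ := h'.exists_family
  have e0 : (a₁ 0).proj = (a₀ 0).proj := by
    rw [← hr 0 unitInterval.zero_mem]; exact (h0 1 unitInterval.one_mem).1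
  have e1 : (a₁ 1).proj = (a₀ 1).proj := by
    rw [← hr 1 unitInterval.one_mem]; exact (h1 1 unitInterval.one_mem).1
  have hcF : ∀ ε ∈ unitInterval, ∀ t ∈ unitInterval, FamilyAt P nabla
      (fun ε t ↦ (c (firstHalf ε) (id t)).rescale (deriv id t) (deriv firstHalf ε)) ε t :=
    fun ε hε t ht ↦ FamilyAt.rescale contDiff_firstHalf contDiff_id (fun s _ ↦ firstHalf_mem s)
      (mapsTo_id _) hε ht (hc _ (firstHalf_mem ε) t ht)
  have hdF : ∀ ε ∈ unitInterval, ∀ t ∈ unitInterval, FamilyAt P nabla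
      (fun ε t ↦ (d (secondHalf ε) (id t)).rescale (deriv id t) (deriv secondHalf ε)) ε t :=
    fun ε hε t ht ↦ FamilyAt.rescale contDiff_secondHalf contDiff_id (fun s _ ↦ secondHalf_mem s)
      (mapsTo_id _) hε ht (hd _ (secondHalf_mem ε) t ht)
  refine homotopic_of (c := fun ε t ↦ if ε ≤ 1 / 2
      then (c (firstHalf ε) (id t)).rescale (deriv id t) (deriv firstHalf ε)
      else (d (secondHalf ε) (id t)).rescale (deriv id t) (deriv secondHalf ε))
    (x := (a₀ 0).proj) (y := (a₀ 1).proj) ?_ ?_ ?_ ?_ ?_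
  · intro ε hε t ht
    by_cases hh : ε ≤ 1 / 2
    · refine (hcF ε hε t ht).congr hε ht ?_
      have hn : ∀ᶠ z : ℝ × ℝ in 𝓝[unitInterval ×ˢ unitInterval] (ε, t), z.1 < 2 / 3 :=
        nhdsWithin_le_nhds (continuous_fst.continuousAt.eventually_lt_const
          (by change ε < 2 / 3; linarith))
      filter_upwards [hn, self_mem_nhdsWithin] with z hz hzU
      split_ifs with hz2
      · rfl
      · rw [firstHalf_eq_one (by linarith), secondHalf_eq_zero hz.le,
          deriv_firstHalf_eq_zero (by linarith), deriv_secondHalf_eq_zero hz.le]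
        exact rescale_eq_of_toBundle_eq ((kl _ hzU.2).trans (hr _ hzU.2).symm) _
    · refine (hdF ε hε t ht).congr hε ht ?_
      have hn : ∀ᶠ z : ℝ × ℝ in 𝓝[unitInterval ×ˢ unitInterval] (ε, t), 1 / 2 < z.1 :=
        nhdsWithin_le_nhds (continuous_fst.continuousAt.eventually_const_lt (not_le.1 hh))
      filter_upwards [hn] with z hz
      rw [if_neg (not_le.2 hz)]
  · exact fun ε _ ↦ end_ite _ (end_rescale (h0 _ (firstHalf_mem ε)) _ _)
      (end_rescale ⟨((k0 _ (secondHalf_mem ε)).1).trans e0, (k0 _ (secondHalf_mem ε)).2⟩ _ _)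
  · exact fun ε _ ↦ end_ite _ (end_rescale (h1 _ (firstHalf_mem ε)) _ _)
      (end_rescale ⟨((k1 _ (secondHalf_mem ε)).1).trans e1, (k1 _ (secondHalf_mem ε)).2⟩ _ _)
  · intro t ht
    rw [← hl t ht, if_pos (by norm_num), toBundle_rescale, deriv_id, scale_one, id, firstHalf,
      cutoff_eq_zero (by norm_num)]
  · intro t ht
    rw [← kr t ht, if_neg (by norm_num), toBundle_rescale, deriv_id, scale_one, id, secondHalf,
      cutoff_eq_one (by norm_num)]

end CotangentPath

/-! ### Concatenation and reversal -/

/-- The concatenation of two paths in `T*M` (first `a`, then `b`), both reparametrized by the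
cutoff function so that the result is again of class `C¹`. -/
def concat (a b : ℝ → CotangentBundle E M) (t : ℝ) : CotangentBundle E M :=
  if t ≤ 1 / 2 then reparam firstHalf a t else reparam secondHalf b t

lemma reparam_firstHalf_eq_zero {a : ℝ → CotangentBundle E M} {x : M} (h : (a 1).proj = x) {t : ℝ}
    (ht : 1 / 3 ≤ t) : reparam firstHalf a t = zeroCovector x := by
  rw [reparam, deriv_firstHalf_eq_zero ht, firstHalf_eq_one ht, scale_zero h]

lemma reparam_secondHalf_eq_zero {a : ℝ → CotangentBundle E M} {x : M} (h : (a 0).proj = x)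
    {t : ℝ} (ht : t ≤ 2 / 3) : reparam secondHalf a t = zeroCovector x := by
  rw [reparam, deriv_secondHalf_eq_zero ht, secondHalf_eq_zero ht, scale_zero h]

lemma reparam_cutoff_eq_zero_left {a : ℝ → CotangentBundle E M} {x : M} (h : (a 0).proj = x)
    {t : ℝ} (ht : t ≤ 1 / 3) : reparam cutoff a t = zeroCovector x := by
  rw [reparam, deriv_cutoff_of_le ht, cutoff_eq_zero ht, scale_zero h]

lemma reparam_cutoff_eq_zero_right {a : ℝ → CotangentBundle E M} {x : M} (h : (a 1).proj = x)
    {t : ℝ} (ht : 2 / 3 ≤ t) : reparam cutoff a t = zeroCovector x := by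
  rw [reparam, deriv_cutoff_of_ge ht, cutoff_eq_one ht, scale_zero h]

lemma pathAt_zeroCovector (P : PoissonStructure E M) (s : Set ℝ) (x : M) (t : ℝ) :
    PathAt P s (fun _ ↦ zeroCovector x) t := by
  refine ⟨contMDiffWithinAt_const, ?_⟩
  have h := hasMFDerivWithinAt_const (I := 𝓘(ℝ, ℝ)) (I' := 𝓘(ℝ, E)) x s t
  have e : ((1 : ℝ →L[ℝ] ℝ).smulRight (P.sharp x 0) : ℝ →L[ℝ] E) = 0 := by
    apply ContinuousLinearMap.ext_ring
    change (1 : ℝ) • (P.sharp x 0 : E) = 0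
    rw [one_smul]
    exact map_zero (P.sharp x)
  exact e ▸ h

lemma pathAt_concat {P : PoissonStructure E M} {a b : ℝ → CotangentBundle E M} {x : M}
    (ha : ∀ t ∈ unitInterval, PathAt P unitInterval a t)
    (hb : ∀ t ∈ unitInterval, PathAt P unitInterval b t)
    (ha1 : (a 1).proj = x) (hb0 : (b 0).proj = x) {t : ℝ} (ht : t ∈ unitInterval) :
    PathAt P unitInterval (concat a b) t := by
  by_cases h : t ≤ 1 / 2
  · refine (PathAt.reparam contDiff_firstHalf (s := unitInterval) (fun s _ ↦ firstHalf_mem s)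
      (ha _ (firstHalf_mem t))).congr ht ?_
    have hn : ∀ᶠ r : ℝ in 𝓝[unitInterval] t, r < 2 / 3 :=
      nhdsWithin_le_nhds (continuousAt_id.eventually_lt_const (by change t < 2 / 3; linarith))
    filter_upwards [hn] with r hr
    by_cases hr2 : r ≤ 1 / 2
    · rw [concat, if_pos hr2]
    · rw [concat, if_neg hr2, reparam_secondHalf_eq_zero hb0 hr.le,
        reparam_firstHalf_eq_zero ha1 (by linarith)]
  · refine (PathAt.reparam contDiff_secondHalf (s := unitInterval) (fun s _ ↦ secondHalf_mem s)
      (hb _ (secondHalf_mem t))).congr ht ?_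
    have hn : ∀ᶠ r : ℝ in 𝓝[unitInterval] t, 1 / 2 < r :=
      nhdsWithin_le_nhds (continuousAt_id.eventually_const_lt (not_le.1 h))
    filter_upwards [hn] with r hr
    rw [concat, if_neg (not_le.2 hr)]

/-- The path that follows `f` up to time `1`, and then `g`. -/
def join (f g : ℝ → CotangentBundle E M) (s : ℝ) : CotangentBundle E M :=
  if s ≤ 1 then f s else g (s - 1)

lemma join_of_le (f g : ℝ → CotangentBundle E M) {s : ℝ} (h : s ≤ 1) : join f g s = f s :=
  if_pos h

lemma join_of_ge {f g : ℝ → CotangentBundle E M} (e : f 1 = g 0) {s : ℝ} (h : 1 ≤ s) :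
    join f g s = g (s - 1) := by
  rcases h.eq_or_lt with rfl | h
  · rw [join_of_le _ _ le_rfl, e, sub_self]
  · exact if_neg (not_le.2 h)

lemma pathAt_join {P : PoissonStructure E M} {f g : ℝ → CotangentBundle E M} {x : M}
    (hf : ∀ t, PathAt P univ f t) (hg : ∀ t, PathAt P univ g t)
    (ef : ∀ t, 2 / 3 ≤ t → f t = zeroCovector x) (eg : ∀ t, t ≤ 1 / 3 → g t = zeroCovector x)
    (t : ℝ) : PathAt P univ (join f g) t := by
  by_cases h : t ≤ 1
  · refine (hf t).congr (mem_univ t) ?_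
    have hn : ∀ᶠ r : ℝ in 𝓝[univ] t, r < 4 / 3 :=
      nhdsWithin_le_nhds (continuousAt_id.eventually_lt_const (by change t < 4 / 3; linarith))
    filter_upwards [hn] with r hr
    by_cases hr2 : r ≤ 1
    · rw [join_of_le _ _ hr2]
    · rw [join, if_neg hr2, eg _ (by linarith), ef _ (by linarith)]
  · have hq : ∀ r, HasDerivAt (fun s : ℝ ↦ s - 1) 1 r := fun r ↦ (hasDerivAt_id r).sub_const 1
    refine (PathAt.reparam (q := fun s : ℝ ↦ s - 1) (by fun_prop) (mapsTo_univ _ univ)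
      (hg (t - 1))).congr (mem_univ t) ?_
    have hn : ∀ᶠ r : ℝ in 𝓝[univ] t, 1 < r :=
      nhdsWithin_le_nhds (continuousAt_id.eventually_const_lt (not_le.1 h))
    filter_upwards [hn] with r hr
    rw [join, if_neg (not_le.2 hr), reparam_eq (hq r), scale_one]

/-- The concatenation of `a` and `b` traverses at double speed the path that follows
`a` and `b` with cutoff. -/
lemma concat_eq_join (a b : ℝ → CotangentBundle E M) {u : ℝ} :
    concat a b u = scale 2 (join (reparam cutoff a) (reparam cutoff b) (2 * u)) := by
  by_cases h : u ≤ 1 / 2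
  · rw [concat, if_pos h, join_of_le _ _ (by linarith), reparam_eq (hasDerivAt_firstHalf u), reparam,
      scale_scale, firstHalf]
  · rw [concat, if_neg h, join, if_neg (by linarith), reparam_eq (hasDerivAt_secondHalf u), reparam,
      scale_scale, secondHalf]

namespace CotangentLoop

variable {P : PoissonStructure E M} {x : M}

/-- A loop from a path in `T*M` that satisfies the conditions on a cotangent path. -/
def ofPathAt (a : ℝ → CotangentBundle E M) (h : ∀ t ∈ unitInterval, PathAt P unitInterval a t)
    (h0 : (a 0).proj = x) (h1 : (a 1).proj = x) : CotangentLoop P x :=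
  ⟨⟨a, fun t ht ↦ (h t ht).smooth, fun t ht ↦ (h t ht).vel⟩, h0, h1⟩

/-- The constant cotangent path `0` at `x`. -/
def const (P : PoissonStructure E M) (x : M) : CotangentLoop P x :=
  ofPathAt (fun _ ↦ zeroCovector x) (fun t _ ↦ pathAt_zeroCovector P _ x t) rfl rfl

/-- The concatenation: first `a`, then `b`. -/
def trans (a b : CotangentLoop P x) : CotangentLoop P x :=
  ofPathAt (concat a.toCotangentPath b.toCotangentPath)
    (fun _ ht ↦ pathAt_concat (fun _ h ↦ a.pathAt h) (fun _ h ↦ b.pathAt h) a.target b.source ht)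
    (by
      rw [concat, if_pos (by norm_num), reparam, firstHalf, cutoff_eq_zero (by norm_num)]
      exact a.source)
    (by
      rw [concat, if_neg (by norm_num), reparam, secondHalf, cutoff_eq_one (by norm_num)]
      exact b.target)

lemma mapsTo_one_sub : MapsTo (fun s : ℝ ↦ 1 - s) unitInterval unitInterval := fun _ hs ↦
  ⟨sub_nonneg.2 hs.2, sub_le_self _ hs.1⟩

/-- The reversed path `t ↦ -a(1 - t)`. -/
def symm (a : CotangentLoop P x) : CotangentLoop P x :=
  ofPathAt (reparam (fun s ↦ 1 - s) a.toCotangentPath)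
    (fun t ht ↦ PathAt.reparam (by fun_prop) mapsTo_one_sub (a.pathAt (mapsTo_one_sub ht)))
    (by
      rw [reparam, sub_zero]
      exact a.target)
    (by
      rw [reparam, sub_self]
      exact a.source)

/-- The reparametrization of a loop by the cutoff function. -/
def slow (a : CotangentLoop P x) : CotangentLoop P x :=
  ofPathAt (reparam cutoff a.toCotangentPath)
    (fun t _ ↦ PathAt.reparam contDiff_cutoff (fun s _ ↦ cutoff_mem s) (a.pathAt (cutoff_mem t)))
    (by
      rw [reparam, cutoff_eq_zero (by norm_num)]
      exact a.source)
    (by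
      rw [reparam, cutoff_eq_one (by norm_num)]
      exact a.target)

/-- Homotopy of loops. -/
def Homotopic (nabla : AffineConnection E M) (a b : CotangentLoop P x) : Prop :=
  CotangentPath.Homotopic nabla a.toCotangentPath b.toCotangentPath

variable {nabla : AffineConnection E M}

lemma homotopic_of {a b : CotangentLoop P x} {c : ℝ → ℝ → CovectorPair E M}
    (hc : ∀ ε ∈ unitInterval, ∀ t ∈ unitInterval, FamilyAt P nabla c ε t)
    (h₀ : ∀ ε ∈ unitInterval, (c ε 0).1 = x ∧ (c ε 0).2.2 = 0)
    (h₁ : ∀ ε ∈ unitInterval, (c ε 1).1 = x ∧ (c ε 1).2.2 = 0)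
    (hl : ∀ t ∈ unitInterval, (c 0 t).toBundle = a.toCotangentPath t)
    (hr : ∀ t ∈ unitInterval, (c 1 t).toBundle = b.toCotangentPath t) : Homotopic nabla a b :=
  CotangentPath.homotopic_of hc h₀ h₁ hl hr

lemma Homotopic.exists_family {a b : CotangentLoop P x} (h : Homotopic nabla a b) :
    ∃ c : ℝ → ℝ → CovectorPair E M,
      (∀ ε ∈ unitInterval, ∀ t ∈ unitInterval, FamilyAt P nabla c ε t) ∧
      (∀ ε ∈ unitInterval, (c ε 0).1 = x ∧ (c ε 0).2.2 = 0) ∧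
      (∀ ε ∈ unitInterval, (c ε 1).1 = x ∧ (c ε 1).2.2 = 0) ∧
      (∀ t ∈ unitInterval, (c 0 t).toBundle = a.toCotangentPath t) ∧
      (∀ t ∈ unitInterval, (c 1 t).toBundle = b.toCotangentPath t) := by
  obtain ⟨c, hc, h0, h1, hl, hr⟩ := CotangentPath.Homotopic.exists_family h
  exact ⟨c, hc, fun ε hε ↦ ⟨(h0 ε hε).1.trans a.source, (h0 ε hε).2⟩,
    fun ε hε ↦ ⟨(h1 ε hε).1.trans a.target, (h1 ε hε).2⟩, hl, hr⟩

lemma Homotopic.trans_congr {a a' b b' : CotangentLoop P x} (h : Homotopic nabla a a')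
    (h' : Homotopic nabla b b') : Homotopic nabla (a.trans b) (a'.trans b') := by
  obtain ⟨c, hc, h0, h1, hl, hr⟩ := h.exists_family
  obtain ⟨d, hd, k0, k1, kl, kr⟩ := h'.exists_family
  have hcF : ∀ ε ∈ unitInterval, ∀ t ∈ unitInterval, FamilyAt P nabla
      (fun ε t ↦ (c (id ε) (firstHalf t)).rescale (deriv firstHalf t) (deriv id ε)) ε t :=
    fun ε hε t ht ↦ FamilyAt.rescale contDiff_id contDiff_firstHalf (mapsTo_id _)
      (fun s _ ↦ firstHalf_mem s) hε ht (hc ε hε _ (firstHalf_mem t))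
  have hdF : ∀ ε ∈ unitInterval, ∀ t ∈ unitInterval, FamilyAt P nabla
      (fun ε t ↦ (d (id ε) (secondHalf t)).rescale (deriv secondHalf t) (deriv id ε)) ε t :=
    fun ε hε t ht ↦ FamilyAt.rescale contDiff_id contDiff_secondHalf (mapsTo_id _)
      (fun s _ ↦ secondHalf_mem s) hε ht (hd ε hε _ (secondHalf_mem t))
  refine homotopic_of (c := fun ε t ↦ if t ≤ 1 / 2
      then (c (id ε) (firstHalf t)).rescale (deriv firstHalf t) (deriv id ε)
      else (d (id ε) (secondHalf t)).rescale (deriv secondHalf t) (deriv id ε)) ?_ ?_ ?_ ?_ ?_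
  · intro ε hε t ht
    by_cases hh : t ≤ 1 / 2
    · refine (hcF ε hε t ht).congr hε ht ?_
      have hn : ∀ᶠ z : ℝ × ℝ in 𝓝[unitInterval ×ˢ unitInterval] (ε, t), z.2 < 2 / 3 :=
        nhdsWithin_le_nhds (continuous_snd.continuousAt.eventually_lt_const
          (by change t < 2 / 3; linarith))
      filter_upwards [hn, self_mem_nhdsWithin] with z hz hzU
      split_ifs with hz2
      · rfl
      · rw [firstHalf_eq_one (by linarith), secondHalf_eq_zero hz.le,
          deriv_firstHalf_eq_zero (by linarith), deriv_secondHalf_eq_zero hz.le,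
          id, rescale_eq_zero (h1 _ hzU.1).1 (h1 _ hzU.1).2,
          rescale_eq_zero (k0 _ hzU.1).1 (k0 _ hzU.1).2]
    · refine (hdF ε hε t ht).congr hε ht ?_
      have hn : ∀ᶠ z : ℝ × ℝ in 𝓝[unitInterval ×ˢ unitInterval] (ε, t), 1 / 2 < z.2 :=
        nhdsWithin_le_nhds (continuous_snd.continuousAt.eventually_const_lt (not_le.1 hh))
      filter_upwards [hn] with z hz
      rw [if_neg (not_le.2 hz)]
  · intro ε hε
    rw [if_pos (by norm_num), firstHalf, cutoff_eq_zero (by norm_num)]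
    exact end_rescale (h0 ε hε) _ _
  · intro ε hε
    rw [if_neg (by norm_num), secondHalf, cutoff_eq_one (by norm_num)]
    exact end_rescale (k1 ε hε) _ _
  · intro t ht
    change _ = concat a.toCotangentPath b.toCotangentPath t
    by_cases hh : t ≤ 1 / 2
    · rw [if_pos hh, concat, if_pos hh, toBundle_rescale, reparam, id, hl _ (firstHalf_mem t)]
    · rw [if_neg hh, concat, if_neg hh, toBundle_rescale, reparam, id, kl _ (secondHalf_mem t)]
  · intro t ht
    change _ = concat a'.toCotangentPath b'.toCotangentPath t
    by_cases hh : t ≤ 1 / 2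
    · rw [if_pos hh, concat, if_pos hh, toBundle_rescale, reparam, id, hr _ (firstHalf_mem t)]
    · rw [if_neg hh, concat, if_neg hh, toBundle_rescale, reparam, id, kr _ (secondHalf_mem t)]

lemma Homotopic.symm_congr {a b : CotangentLoop P x} (h : Homotopic nabla a b) :
    Homotopic nabla a.symm b.symm := by
  obtain ⟨c, hc, h0, h1, hl, hr⟩ := h.exists_family
  refine homotopic_of (c := fun ε t ↦ (c (id ε) (1 - t)).rescale
    (deriv (fun s : ℝ ↦ 1 - s) t) (deriv id ε)) ?_ ?_ ?_ ?_ ?_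
  · exact fun ε hε t ht ↦ FamilyAt.rescale (q := fun s ↦ 1 - s) contDiff_id (by fun_prop)
      (mapsTo_id _) mapsTo_one_sub hε ht (hc ε hε _ (mapsTo_one_sub ht))
  · intro ε hε
    rw [sub_zero]
    exact end_rescale (h1 ε hε) _ _
  · intro ε hε
    rw [sub_self]
    exact end_rescale (h0 ε hε) _ _
  · intro t ht
    rw [toBundle_rescale, id, hl _ (mapsTo_one_sub ht)]
    rfl
  · intro t ht
    rw [toBundle_rescale, id, hr _ (mapsTo_one_sub ht)]
    rfl

lemma homotopic_of_reparam {a : ℝ → CotangentBundle E M} {s : Set ℝ} (hs : Convex ℝ s)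
    (h : ∀ r ∈ s, PathAt P s a r) {q₀ q₁ : ℝ → ℝ} (hq₀ : ContDiff ℝ 2 q₀) (hq₁ : ContDiff ℝ 2 q₁)
    (hm₀ : MapsTo q₀ unitInterval s) (hm₁ : MapsTo q₁ unitInterval s)
    (h0 : q₁ 0 = q₀ 0) (h1 : q₁ 1 = q₀ 1) {a₀ a₁ : CotangentLoop P x}
    (e₀ : ∀ t ∈ unitInterval, a₀.toCotangentPath t = reparam q₀ a t)
    (e₁ : ∀ t ∈ unitInterval, a₁.toCotangentPath t = reparam q₁ a t) : Homotopic nabla a₀ a₁ :=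
  CotangentPath.homotopic_of_reparam hs h hq₀ hq₁ hm₀ hm₁ h0 h1 e₀ e₁

lemma cutoff_zero : cutoff 0 = 0 := cutoff_eq_zero (by norm_num)

lemma cutoff_one : cutoff 1 = 1 := cutoff_eq_one (by norm_num)

lemma firstHalf_zero : firstHalf 0 = 0 := by rw [firstHalf, mul_zero, cutoff_zero]

lemma firstHalf_one : firstHalf 1 = 1 := firstHalf_eq_one (by norm_num)

lemma secondHalf_zero : secondHalf 0 = 0 := secondHalf_eq_zero (by norm_num)

lemma secondHalf_one : secondHalf 1 = 1 := cutoff_eq_one (by norm_num)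

lemma homotopic_slow (a : CotangentLoop P x) : Homotopic nabla a a.slow := by
  refine homotopic_of_reparam (convex_Icc 0 1) (fun r hr ↦ a.pathAt hr) (q₀ := id) (q₁ := cutoff)
    contDiff_id contDiff_cutoff (mapsTo_id _) (fun s _ ↦ cutoff_mem s) cutoff_zero cutoff_one ?_ ?_
  · intro t _
    rw [reparam_eq (hasDerivAt_id t), scale_one]
    rfl
  · exact fun t _ ↦ rfl

lemma homotopic_const_trans (a : CotangentLoop P x) :
    Homotopic nabla ((const P x).trans a) a := by
  refine homotopic_of_reparam (convex_Icc 0 1) (fun r hr ↦ a.pathAt hr) (q₀ := secondHalf)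
    (q₁ := id) contDiff_secondHalf contDiff_id (fun s _ ↦ secondHalf_mem s) (mapsTo_id _)
    secondHalf_zero.symm secondHalf_one.symm ?_ ?_
  · intro t _
    change concat (const P x).toCotangentPath a.toCotangentPath t = _
    by_cases h : t ≤ 1 / 2
    · rw [concat, if_pos h, reparam_secondHalf_eq_zero a.source (by linarith)]
      exact scale_zeroCovector _ _
    · rw [concat, if_neg h]
  · intro t _
    rw [reparam_eq (hasDerivAt_id t), scale_one]
    rfl

lemma homotopic_symm_trans (a : CotangentLoop P x) :
    Homotopic nabla (a.symm.trans a) (const P x) := by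
  have hd : ∀ t, HasDerivAt (fun t ↦ 1 - firstHalf t + secondHalf t)
      (-(deriv firstHalf t) + deriv secondHalf t) t := fun t ↦
    ((contDiff_firstHalf.differentiable (by simp)).differentiableAt.hasDerivAt.const_sub 1).add
      (contDiff_secondHalf.differentiable (by simp)).differentiableAt.hasDerivAt
  refine homotopic_of_reparam (convex_Icc 0 1) (fun r hr ↦ a.pathAt hr)
    (q₀ := fun t ↦ 1 - firstHalf t + secondHalf t) (q₁ := fun _ ↦ 1)
    ((contDiff_const.sub contDiff_firstHalf).add contDiff_secondHalf) contDiff_const ?_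
    (fun _ _ ↦ unitInterval.one_mem) ?_ ?_ ?_ ?_
  · intro t _
    by_cases h : t ≤ 1 / 2
    · simp only [secondHalf_eq_zero (show t ≤ 2 / 3 by linarith), add_zero]
      exact mapsTo_one_sub (firstHalf_mem t)
    · simp only [firstHalf_eq_one (show 1 / 3 ≤ t by linarith), sub_self, zero_add]
      exact secondHalf_mem t
  · simp only [firstHalf_zero, secondHalf_zero, sub_zero, add_zero]
  · simp only [firstHalf_one, secondHalf_one, sub_self, zero_add]
  · intro t _
    change concat a.symm.toCotangentPath a.toCotangentPath t = _
    rw [reparam_eq (hd t)]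
    by_cases h : t ≤ 1 / 2
    · rw [concat, if_pos h, secondHalf_eq_zero (by linarith), deriv_secondHalf_eq_zero (by linarith),
        add_zero, add_zero, reparam]
      change scale (deriv firstHalf t) (reparam (fun s ↦ 1 - s) a.toCotangentPath (firstHalf t)) = _
      have hq : HasDerivAt (fun s : ℝ ↦ 1 - s) (-1) (firstHalf t) := (hasDerivAt_id _).const_sub 1
      rw [reparam_eq hq, scale_scale, mul_neg_one]
    · rw [concat, if_neg h, firstHalf_eq_one (by linarith), deriv_firstHalf_eq_zero (by linarith),
        sub_self, zero_add, neg_zero, zero_add, reparam]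
  · intro t _
    rw [reparam_eq (hasDerivAt_const t (1 : ℝ)), scale_zero a.target]
    rfl

lemma pathAt_slow (a : CotangentLoop P x) (t : ℝ) :
    PathAt P univ (reparam cutoff a.toCotangentPath) t :=
  PathAt.reparam contDiff_cutoff (fun s _ ↦ cutoff_mem s) (a.pathAt (cutoff_mem t))

lemma homotopic_assoc (a b c : CotangentLoop P x) :
    Homotopic nabla ((a.trans b).trans c.slow) (a.slow.trans (b.trans c)) := by
  set f := reparam cutoff a.toCotangentPath with hf
  set g := reparam cutoff b.toCotangentPath with hg
  set k := reparam cutoff c.toCotangentPath with hk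
  have f1 : ∀ t, 2 / 3 ≤ t → f t = zeroCovector x := fun t ht ↦
    reparam_cutoff_eq_zero_right a.target ht
  have g0 : ∀ t, t ≤ 1 / 3 → g t = zeroCovector x := fun t ht ↦
    reparam_cutoff_eq_zero_left b.source ht
  have g1 : ∀ t, 2 / 3 ≤ t → g t = zeroCovector x := fun t ht ↦
    reparam_cutoff_eq_zero_right b.target ht
  have k0 : ∀ t, t ≤ 1 / 3 → k t = zeroCovector x := fun t ht ↦
    reparam_cutoff_eq_zero_left c.source ht
  have e1 : g 1 = k 0 := (g1 1 (by norm_num)).trans (k0 0 (by norm_num)).symm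
  have e0 : f 1 = join g k 0 := by
    rw [f1 1 (by norm_num), join_of_le _ _ zero_le_one, g0 0 (by norm_num)]
  have hP : ∀ t, PathAt P univ (join f (join g k)) t := by
    refine pathAt_join (pathAt_slow a) (pathAt_join (pathAt_slow b) (pathAt_slow c) g1 k0) f1 ?_
    intro t ht
    rw [join_of_le _ _ (by linarith), g0 t ht]
  have d1 : ∀ t, HasDerivAt firstHalf (deriv firstHalf t) t := fun t ↦
    (contDiff_firstHalf.differentiable (by simp)).differentiableAt.hasDerivAt
  have d2 : ∀ t, HasDerivAt secondHalf (deriv secondHalf t) t := fun t ↦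
    (contDiff_secondHalf.differentiable (by simp)).differentiableAt.hasDerivAt
  refine homotopic_of_reparam (a := join f (join g k)) convex_univ (fun r _ ↦ hP r)
    (q₀ := fun t ↦ 2 * firstHalf t + secondHalf t) (q₁ := fun t ↦ firstHalf t + 2 * secondHalf t)
    ((contDiff_const.mul contDiff_firstHalf).add contDiff_secondHalf)
    (contDiff_firstHalf.add (contDiff_const.mul contDiff_secondHalf))
    (mapsTo_univ _ _) (mapsTo_univ _ _) ?_ ?_ ?_ ?_
  · simp only [firstHalf_zero, secondHalf_zero, mul_zero]
  · simp only [firstHalf_one, secondHalf_one]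
    norm_num
  · intro t _
    have hq : HasDerivAt (fun t ↦ 2 * firstHalf t + secondHalf t)
      (2 * deriv firstHalf t + deriv secondHalf t) t := ((d1 t).const_mul 2).add (d2 t)
    rw [reparam_eq hq]
    change concat (concat a.toCotangentPath b.toCotangentPath) k t = _
    by_cases h : t ≤ 1 / 2
    · have hu := firstHalf_mem t
      rw [concat, if_pos h, secondHalf_eq_zero (by linarith), deriv_secondHalf_eq_zero (by linarith),
        add_zero, add_zero, reparam, concat_eq_join, scale_scale, mul_comm 2 (deriv firstHalf t)]
      congr 1
      by_cases hu2 : 2 * firstHalf t ≤ 1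
      · rw [join_of_le _ _ hu2, join_of_le _ _ hu2]
      · rw [join, if_neg hu2, join, if_neg hu2, join_of_le _ _ (by linarith [hu.2])]
    · have hu := secondHalf_mem t
      rw [concat, if_neg h, firstHalf_eq_one (by linarith), deriv_firstHalf_eq_zero (by linarith),
        mul_zero, zero_add, reparam, join_of_ge e0 (by linarith [hu.1]),
        join_of_ge e1 (by linarith [hu.1])]
      congr 2
      ring
  · intro t _
    have hq : HasDerivAt (fun t ↦ firstHalf t + 2 * secondHalf t)
      (deriv firstHalf t + 2 * deriv secondHalf t) t := (d1 t).add ((d2 t).const_mul 2)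
    rw [reparam_eq hq]
    change concat f (concat b.toCotangentPath c.toCotangentPath) t = _
    by_cases h : t ≤ 1 / 2
    · rw [concat, if_pos h, secondHalf_eq_zero (by linarith), deriv_secondHalf_eq_zero (by linarith),
        mul_zero, add_zero, add_zero, join_of_le _ _ (firstHalf_mem t).2, reparam]
    · have hu := secondHalf_mem t
      rw [concat, if_neg h, firstHalf_eq_one (by linarith), deriv_firstHalf_eq_zero (by linarith),
        zero_add, reparam, concat_eq_join, scale_scale, join_of_ge e0 (by linarith [hu.1]),
        add_sub_cancel_left, mul_comm 2 (deriv secondHalf t)]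

end CotangentLoop

/-! ### The group of homotopy classes -/

/-- Cotangent homotopy as an equivalence relation on the cotangent loops at `x`. -/
def loopSetoid (P : PoissonStructure E M) (nabla : AffineConnection E M) (x : M) :
    Setoid (CotangentLoop P x) where
  r := CotangentLoop.Homotopic nabla
  iseqv := ⟨fun a ↦ CotangentPath.Homotopic.refl a.toCotangentPath,
    fun h ↦ CotangentPath.Homotopic.symm h, fun h h' ↦ CotangentPath.Homotopic.trans h h'⟩

/-- The group `Σ(M, x)` of cotangent homotopy classes of cotangent paths whose base path starts and
ends at `x`. The product is concatenation. -/
def IsotropyGroup (P : PoissonStructure E M) (nabla : AffineConnection E M) (x : M) : Type _ :=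
  Quotient (loopSetoid P nabla x)

namespace IsotropyGroup

variable {P : PoissonStructure E M} {nabla : AffineConnection E M} {x : M}

/-- The class of a cotangent loop. -/
def mk (nabla : AffineConnection E M) (a : CotangentLoop P x) : IsotropyGroup P nabla x :=
  Quotient.mk (loopSetoid P nabla x) a

instance : Mul (IsotropyGroup P nabla x) :=
  ⟨Quotient.map₂ CotangentLoop.trans fun _ _ h _ _ h' ↦
    CotangentLoop.Homotopic.trans_congr h h'⟩

instance : One (IsotropyGroup P nabla x) := ⟨mk nabla (CotangentLoop.const P x)⟩

instance : Inv (IsotropyGroup P nabla x) :=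
  ⟨Quotient.map CotangentLoop.symm fun _ _ h ↦ CotangentLoop.Homotopic.symm_congr h⟩

lemma mk_eq {a b : CotangentLoop P x} (h : CotangentLoop.Homotopic nabla a b) :
    mk nabla a = mk nabla b := Quotient.sound h

lemma mk_mul_mk (a b : CotangentLoop P x) : mk nabla a * mk nabla b = mk nabla (a.trans b) := rfl

instance : Group (IsotropyGroup P nabla x) :=
  Group.ofLeftAxioms
    (by
      rintro ⟨a⟩ ⟨b⟩ ⟨c⟩
      change mk nabla a * mk nabla b * mk nabla c = mk nabla a * (mk nabla b * mk nabla c)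
      calc mk nabla (a.trans b) * mk nabla c
          = mk nabla (a.trans b) * mk nabla c.slow := by
            rw [mk_eq (CotangentLoop.homotopic_slow c)]
        _ = mk nabla a.slow * mk nabla (b.trans c) := mk_eq (CotangentLoop.homotopic_assoc a b c)
        _ = mk nabla a * mk nabla (b.trans c) := by
            rw [← mk_eq (CotangentLoop.homotopic_slow a)])
    (by
      rintro ⟨a⟩
      exact mk_eq (CotangentLoop.homotopic_const_trans a))
    (by
      rintro ⟨a⟩
      exact mk_eq (CotangentLoop.homotopic_symm_trans a))

end IsotropyGroup

/-! ### Poisson cohomology in degree one -/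

/-- The derivative `X(f)` of a function along a vector field. -/
def lieDeriv (X : SmoothVectorField E M) (f : M → ℝ) (x : M) : ℝ := mvfderiv 𝓘(ℝ, E) f x (X x)

lemma contMDiff_lieDeriv (X : SmoothVectorField E M) {f : M → ℝ}
    (hf : ContMDiff 𝓘(ℝ, E) 𝓘(ℝ, ℝ) ∞ f) : ContMDiff 𝓘(ℝ, E) 𝓘(ℝ, ℝ) ∞ (lieDeriv X f) :=
  (contMDiff_snd_tangentBundle_modelSpace ℝ 𝓘(ℝ, ℝ)).comp
    ((hf.contMDiff_tangentMap (m := ∞) (by simp)).comp X.contMDiff)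

lemma lieDeriv_add (X Y : SmoothVectorField E M) (f : M → ℝ) :
    lieDeriv (X + Y) f = lieDeriv X f + lieDeriv Y f :=
  funext fun x ↦ map_add (mvfderiv 𝓘(ℝ, E) f x) (X x) (Y x)

lemma lieDeriv_smul (r : ℝ) (X : SmoothVectorField E M) (f : M → ℝ) :
    lieDeriv (r • X) f = fun x ↦ r * lieDeriv X f x :=
  funext fun x ↦ map_smul (mvfderiv 𝓘(ℝ, E) f x) r (X x)

lemma lieDeriv_zero (f : M → ℝ) : lieDeriv (0 : SmoothVectorField E M) f = fun _ ↦ 0 :=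
  funext fun x ↦ map_zero (mvfderiv 𝓘(ℝ, E) f x)

lemma mvfderiv_const_mul (r : ℝ) {f : M → ℝ} {x : M} (hf : MDifferentiableAt 𝓘(ℝ, E) 𝓘(ℝ, ℝ) f x) :
    mvfderiv 𝓘(ℝ, E) (fun y ↦ r * f y) x = r • mvfderiv 𝓘(ℝ, E) f x := by
  have h := mvfderiv_fun_mul (I := 𝓘(ℝ, E)) (f := fun _ : M ↦ r) (x := x)
    mdifferentiableAt_const hf
  rw [h, mvfderiv_const, smul_zero, add_zero]

namespace PoissonStructure

variable (P : PoissonStructure E M)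

lemma bracket_add_left {f f' : M → ℝ} (g : M → ℝ) (hf : ContMDiff 𝓘(ℝ, E) 𝓘(ℝ, ℝ) ∞ f)
    (hf' : ContMDiff 𝓘(ℝ, E) 𝓘(ℝ, ℝ) ∞ f') (x : M) :
    P.bracket (f + f') g x = P.bracket f g x + P.bracket f' g x := by
  have h := mvfderiv_add (I := 𝓘(ℝ, E)) (x := x) (hf.mdifferentiableAt (by simp))
    (hf'.mdifferentiableAt (by simp))
  simp only [bracket, bracketOf]
  rw [h]
  exact (congrArg (mvfderiv 𝓘(ℝ, E) g x) (map_add (P.sharp x) _ _)).trans (map_add _ _ _)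

lemma bracket_mul_left (r : ℝ) {f : M → ℝ} (g : M → ℝ) (hf : ContMDiff 𝓘(ℝ, E) 𝓘(ℝ, ℝ) ∞ f)
    (x : M) : P.bracket (fun y ↦ r * f y) g x = r * P.bracket f g x := by
  simp only [bracket, bracketOf]
  rw [mvfderiv_const_mul r (hf.mdifferentiableAt (by simp))]
  exact (congrArg (mvfderiv 𝓘(ℝ, E) g x) (map_smul (P.sharp x) r _)).trans (map_smul _ _ _)

lemma bracket_skew (f g : M → ℝ) (x : M) : P.bracket f g x = - P.bracket g f x :=
  P.skew x _ _

/-- The Poisson vector fields: the smooth vector fields `X` with `L_X Π = 0`, that is, with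
`X{f, g} = {X(f), g} + {f, X(g)}`. -/
def poissonFields : Submodule ℝ (SmoothVectorField E M) where
  carrier := {X | ∀ f g : M → ℝ, ContMDiff 𝓘(ℝ, E) 𝓘(ℝ, ℝ) ∞ f → ContMDiff 𝓘(ℝ, E) 𝓘(ℝ, ℝ) ∞ g →
    ∀ x, lieDeriv X (P.bracket f g) x = P.bracket (lieDeriv X f) g x + P.bracket f (lieDeriv X g) x}
  add_mem' := by
    intro X Y hX hY f g hf hg x
    have h1 := P.bracket_add_left g (contMDiff_lieDeriv X hf) (contMDiff_lieDeriv Y hf) x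
    have h2 := P.bracket_add_left f (contMDiff_lieDeriv X hg) (contMDiff_lieDeriv Y hg) x
    have h3 := hX f g hf hg x
    have h4 := hY f g hf hg x
    rw [P.bracket_skew f] at h3 h4
    rw [lieDeriv_add, lieDeriv_add, lieDeriv_add, P.bracket_skew f, h1, h2, Pi.add_apply, h3, h4]
    ring
  zero_mem' := by
    intro f g hf hg x
    have h : ∀ k, P.bracket (fun _ ↦ 0) k x = 0 := fun k ↦ by
      have := P.bracket_mul_left 0 k hf x
      simpa using this
    rw [lieDeriv_zero, lieDeriv_zero, lieDeriv_zero, P.bracket_skew f, h, h, neg_zero, add_zero]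
  smul_mem' := by
    intro r X hX f g hf hg x
    have h1 := P.bracket_mul_left r g (contMDiff_lieDeriv X hf) x
    have h2 := P.bracket_mul_left r f (contMDiff_lieDeriv X hg) x
    have h3 := hX f g hf hg x
    rw [P.bracket_skew f] at h3
    rw [lieDeriv_smul, lieDeriv_smul, lieDeriv_smul, P.bracket_skew f, h1, h2]
    beta_reduce
    rw [h3]
    ring

/-- The Hamiltonian vector fields `X_h = {·, h} = -#dh` of the smooth functions `h`. -/
def hamiltonianFields : Submodule ℝ (SmoothVectorField E M) where
  carrier := {X | ∃ h : M → ℝ, ContMDiff 𝓘(ℝ, E) 𝓘(ℝ, ℝ) ∞ h ∧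
    ∀ x, X x = - P.sharp x (mvfderiv 𝓘(ℝ, E) h x)}
  add_mem' := by
    rintro X Y ⟨h, hh, eh⟩ ⟨k, hk, ek⟩
    refine ⟨h + k, hh.add hk, fun x ↦ ?_⟩
    have e := mvfderiv_add (I := 𝓘(ℝ, E)) (x := x) (hh.mdifferentiableAt (by simp))
      (hk.mdifferentiableAt (by simp))
    have e2 : P.sharp x (mvfderiv 𝓘(ℝ, E) h x + mvfderiv 𝓘(ℝ, E) k x)
      = P.sharp x (mvfderiv 𝓘(ℝ, E) h x) + P.sharp x (mvfderiv 𝓘(ℝ, E) k x) := map_add _ _ _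
    rw [e, e2, neg_add, ← eh, ← ek]
    rfl
  zero_mem' := by
    refine ⟨fun _ ↦ 0, contMDiff_const, fun x ↦ ?_⟩
    rw [mvfderiv_const]
    have e2 : P.sharp x 0 = 0 := map_zero _
    rw [e2, neg_zero]
    rfl
  smul_mem' := by
    rintro r X ⟨h, hh, eh⟩
    refine ⟨fun x ↦ r * h x, contMDiff_const.mul hh, fun x ↦ ?_⟩
    rw [mvfderiv_const_mul r (hh.mdifferentiableAt (by simp)), sharp_smul, ← smul_neg, ← eh]
    rfl

/-- The first Poisson cohomology `H¹_Π(M)`: Poisson vector fields modulo Hamiltonian vector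
fields. -/
abbrev Cohomology1 : Type _ := P.poissonFields ⧸ P.hamiltonianFields.submoduleOf P.poissonFields

end PoissonStructure

end Definitions
end PoissonGeometry
end

/-!
The difficulty is the homotopy invariance. Let `γ` be the base points of the family, `X` a Poisson
vector field and `w = ∂_ε γ - #b`. Evaluated on `X`, the torsion loses its derivative terms, because
`L_X Π = 0`: it becomes `T_∇(a, b)(X) = a(∇_{#b} X) - b(∇_{#a} X)`
(`PoissonStructure.torsion_eq_of_mem_poissonFields`). The derivation property that defines Poisson
vector fields gives `(L_X Π)(df, dg) = 0`, and tensoriality extends this to all 1-forms. The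
variation equation on `X` therefore reads

  `∂_ε⟨a, X⟩ - ∂_t⟨b, X⟩ = ⟨a, ∇_w X⟩` (`FamilyAt.hasDerivWithinAt_pair`).

If `w = 0`, integration over `t` gives `d/dε ∫_{a_ε} X = ⟨b, X⟩(ε, 1) - ⟨b, X⟩(ε, 0) = 0`.

The vanishing of `w` comes from the same identity. For every function `f` the Hamiltonian vector
field `X_f` is Poisson, by the Jacobi identity, and `⟨a, X_f⟩ = df(#a) = ∂_t f(γ)`. Since `∂_ε` and
`∂_t` commute on `f(γ)`, the identity for `X_f` becomes `∂_t df(w) = ⟨a, ∇_w X_f⟩`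
(`hasDerivWithinAt_mvfderiv_defect`). With coordinate functions for `f` this is a linear differential
equation for `w` along `γ`, and `w(ε, 0) = 0` because the initial point is fixed; so `w = 0` by
Gronwall's inequality (`defect_eq_zero`). The commutation of the derivatives is an integrated
statement, since `γ` is only known to be `C¹` in `(ε, t)`, with `∂_t γ = #a` of class `C¹`.

The homomorphism needs two further facts. Along a loop `∫_a X_h` is the total variation of `h`
along the base path, hence `0`, so that the integral descends to `H¹_Π(M)`. Cutoff
reparametrizations do not change integrals, so that concatenation becomes addition.
-/
noncomputable section

namespace PoissonGeometry

/-! ### Functions on the unit square -/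

section

lemma uniqueDiffOn_unitSquare : UniqueDiffOn ℝ (unitInterval ×ˢ unitInterval : Set (ℝ × ℝ)) :=
  uniqueDiffOn_Icc_zero_one.prod uniqueDiffOn_Icc_zero_one

lemma uIcc_subset_unitInterval {t : ℝ} (ht : t ∈ unitInterval) : uIcc 0 t ⊆ unitInterval := by
  rw [uIcc_of_le ht.1]
  exact Icc_subset_Icc_right ht.2

lemma uIoc_subset_unitInterval {t : ℝ} (ht : t ∈ unitInterval) : uIoc 0 t ⊆ unitInterval :=
  uIoc_subset_uIcc.trans (uIcc_subset_unitInterval ht)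

section Square

variable {h : ℝ × ℝ → ℝ}

lemma hasDerivWithinAt_slice (hh : ContDiffOn ℝ 1 h (unitInterval ×ˢ unitInterval)) {ε t : ℝ}
    (hε : ε ∈ unitInterval) (ht : t ∈ unitInterval) :
    HasDerivWithinAt (fun e ↦ h (e, t))
      (fderivWithin ℝ h (unitInterval ×ˢ unitInterval) (ε, t) (1, 0)) unitInterval ε :=
  HasFDerivWithinAt.comp_hasDerivWithinAt (f := fun e : ℝ ↦ (e, t)) ε
    ((hh.differentiableOn (by simp)) (ε, t) ⟨hε, ht⟩).hasFDerivWithinAt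
    ((hasDerivAt_id ε).prodMk (hasDerivAt_const ε t)).hasDerivWithinAt (fun _ he ↦ ⟨he, ht⟩)

lemma continuousOn_derivWithin_slice
    (hh : ContDiffOn ℝ 1 h (unitInterval ×ˢ unitInterval)) :
    ContinuousOn (fun z : ℝ × ℝ ↦ derivWithin (fun e ↦ h (e, z.2)) unitInterval z.1)
      (unitInterval ×ˢ unitInterval) := by
  have hc : ContinuousOn (fun z ↦ fderivWithin ℝ h (unitInterval ×ˢ unitInterval) z (1, 0))
      (unitInterval ×ˢ unitInterval) :=
    (hh.continuousOn_fderivWithin uniqueDiffOn_unitSquare le_rfl).clm_apply continuousOn_const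
  refine hc.congr fun z hz ↦ ?_
  exact (hasDerivWithinAt_slice hh hz.1 hz.2).derivWithin
    (uniqueDiffOn_Icc_zero_one.uniqueDiffWithinAt hz.1)

lemma continuousOn_slice {h : ℝ × ℝ → ℝ} (hh : ContinuousOn h (unitInterval ×ˢ unitInterval))
    {ε : ℝ} (hε : ε ∈ unitInterval) : ContinuousOn (fun s ↦ h (ε, s)) unitInterval :=
  hh.comp (f := fun s : ℝ ↦ (ε, s)) (by fun_prop) (fun _ hs ↦ ⟨hε, hs⟩)

/-- Differentiation under the integral sign, for a `C¹` function on the unit square. -/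
lemma hasDerivAt_integral_slice (hh : ContDiffOn ℝ 1 h (unitInterval ×ˢ unitInterval)) {ε t : ℝ}
    (hε : ε ∈ Ioo (0 : ℝ) 1) (ht : t ∈ unitInterval) :
    HasDerivAt (fun e ↦ ∫ s in (0 : ℝ)..t, h (e, s))
      (∫ s in (0 : ℝ)..t, derivWithin (fun e ↦ h (e, s)) unitInterval ε) ε := by
  have hD := continuousOn_derivWithin_slice hh
  obtain ⟨C, hC⟩ := (isCompact_Icc.prod isCompact_Icc).exists_bound_of_continuousOn hD
  have hmeas : ∀ {k : ℝ → ℝ}, ContinuousOn k unitInterval → IntervalIntegrable k volume 0 t :=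
    fun hk ↦ (hk.mono (uIcc_subset_unitInterval ht)).intervalIntegrable
  have hasm : ∀ {k : ℝ → ℝ}, ContinuousOn k unitInterval →
      AEStronglyMeasurable k (volume.restrict (uIoc 0 t)) := fun hk ↦
    (hk.mono (uIoc_subset_unitInterval ht)).aestronglyMeasurable measurableSet_uIoc
  have hε' : ε ∈ unitInterval := Ioo_subset_Icc_self hε
  refine (intervalIntegral.hasDerivAt_integral_of_dominated_loc_of_deriv_le
    (F := fun e s ↦ h (e, s)) (F' := fun e s ↦ derivWithin (fun e ↦ h (e, s)) unitInterval e)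
    (s := Ioo 0 1) (bound := fun _ ↦ C) (isOpen_Ioo.mem_nhds hε) ?_
    (hmeas (continuousOn_slice hh.continuousOn hε'))
    (hasm (continuousOn_slice hD hε')) ?_ (by simp) ?_).2
  · filter_upwards [isOpen_Ioo.mem_nhds hε] with e he
    exact hasm (continuousOn_slice hh.continuousOn (Ioo_subset_Icc_self he))
  · refine Filter.Eventually.of_forall fun s hs e he ↦ ?_
    exact hC (e, s) ⟨Ioo_subset_Icc_self he, uIoc_subset_unitInterval ht hs⟩
  · refine Filter.Eventually.of_forall fun s hs e he ↦ ?_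
    have := hasDerivWithinAt_slice hh (Ioo_subset_Icc_self he) (uIoc_subset_unitInterval ht hs)
    exact (this.differentiableWithinAt.hasDerivWithinAt).hasDerivAt (Icc_mem_nhds he.1 he.2)

lemma continuousOn_integral_slice (hh : ContinuousOn h (unitInterval ×ˢ unitInterval)) :
    ContinuousOn (fun e ↦ ∫ s in (0 : ℝ)..1, h (e, s)) unitInterval := by
  -- Replacing `h` by its composition with the projection to the square makes it continuous on `ℝ²`.
  set p : ℝ → ℝ := fun r ↦ projIcc 0 1 zero_le_one r with hp
  have hpc : Continuous p := continuous_subtype_val.comp continuous_projIcc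
  have hpm : ∀ r, p r ∈ unitInterval := fun r ↦ (projIcc 0 1 zero_le_one r).2
  have hpe : ∀ r ∈ unitInterval, p r = r := fun r hr ↦
    congrArg Subtype.val (projIcc_of_mem zero_le_one hr)
  have hc : Continuous (Function.uncurry fun e s ↦ h (p e, p s)) :=
    hh.comp_continuous (f := fun z : ℝ × ℝ ↦ (p z.1, p z.2)) (by fun_prop)
      fun z ↦ ⟨hpm z.1, hpm z.2⟩
  refine (intervalIntegral.continuous_parametric_intervalIntegral_of_continuous' (μ := volume) hc 0 1
    ).continuousOn.congr fun e he ↦ ?_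
  refine intervalIntegral.integral_congr fun s hs ↦ ?_
  rw [uIcc_of_le zero_le_one] at hs
  simp only [hpe e he, hpe s hs]

end Square

end

/-! ### Vector fields and differentials of functions -/

section

variable {E : Type*} [NormedAddCommGroup E] [NormedSpace ℝ E]
  {M : Type*} [TopologicalSpace M] [ChartedSpace E M] [IsManifold 𝓘(ℝ, E) ∞ M]

lemma contMDiff_mvfderiv {f : M → ℝ} (hf : ContMDiff 𝓘(ℝ, E) 𝓘(ℝ, ℝ) ∞ f) :
    ContMDiff 𝓘(ℝ, E) (𝓘(ℝ, E).prod 𝓘(ℝ, E →L[ℝ] ℝ)) ∞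
      (fun x ↦ (⟨x, mvfderiv 𝓘(ℝ, E) f x⟩ : CotangentBundle E M)) := by
  intro x
  rw [contMDiffAt_hom_bundle]
  refine ⟨contMDiffAt_id, ?_⟩
  have h := (hf x).mfderiv_const (m := ∞) (by simp)
  refine h.congr_of_eventuallyEq ?_
  refine Filter.Eventually.of_forall fun y ↦ ?_
  simp only [inTangentCoordinates, ContinuousLinearMap.inCoordinates, mvfderiv]
  ext v
  simp
  rfl

omit [IsManifold 𝓘(ℝ, E) ∞ M] in
lemma mvfderiv_eq_fderiv {f : M → ℝ} {x : M} (hf : MDifferentiableAt 𝓘(ℝ, E) 𝓘(ℝ, ℝ) f x) :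
    mvfderiv 𝓘(ℝ, E) f x = fderiv ℝ (f ∘ (extChartAt 𝓘(ℝ, E) x).symm) (extChartAt 𝓘(ℝ, E) x x) := by
  ext v
  simp only [mvfderiv, hf.mfderiv, modelWithCornersSelf_coe, range_id, fderivWithin_univ]
  rfl

lemma two_le_infty : (2 : WithTop ℕ∞) ≤ ∞ := by
  have h : ((2 : ℕ∞) : WithTop ℕ∞) ≤ ((⊤ : ℕ∞) : WithTop ℕ∞) := WithTop.coe_le_coe.2 le_top
  exact h

variable [CompleteSpace E]

/-- The bracket of vector fields is the commutator of the derivations. -/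
lemma mvfderiv_mlieBracket {f : M → ℝ} (hf : ContMDiff 𝓘(ℝ, E) 𝓘(ℝ, ℝ) ∞ f)
    {V W : ∀ x : M, TangentSpace 𝓘(ℝ, E) x} {x : M}
    (hV : MDifferentiableAt 𝓘(ℝ, E) (𝓘(ℝ, E).prod 𝓘(ℝ, E))
      (fun y ↦ (⟨y, V y⟩ : TotalSpace E (TangentSpace 𝓘(ℝ, E) : M → Type _))) x)
    (hW : MDifferentiableAt 𝓘(ℝ, E) (𝓘(ℝ, E).prod 𝓘(ℝ, E))
      (fun y ↦ (⟨y, W y⟩ : TotalSpace E (TangentSpace 𝓘(ℝ, E) : M → Type _))) x) :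
    mvfderiv 𝓘(ℝ, E) f x (VectorField.mlieBracket 𝓘(ℝ, E) V W x)
      = mvfderiv 𝓘(ℝ, E) (fun y ↦ mvfderiv 𝓘(ℝ, E) f y (W y)) x (V x)
        - mvfderiv 𝓘(ℝ, E) (fun y ↦ mvfderiv 𝓘(ℝ, E) f y (V y)) x (W x) := by
  have : IsManifold 𝓘(ℝ, E) 2 M := IsManifold.of_le (n := ∞) two_le_infty
  set φ := (extChartAt 𝓘(ℝ, E) x).symm with hφ
  set c := extChartAt 𝓘(ℝ, E) x x with hc
  have hdf : ∀ {U : ∀ x : M, TangentSpace 𝓘(ℝ, E) x},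
      MDifferentiableAt 𝓘(ℝ, E) (𝓘(ℝ, E).prod 𝓘(ℝ, E))
        (fun y ↦ (⟨y, U y⟩ : TotalSpace E (TangentSpace 𝓘(ℝ, E) : M → Type _))) x →
      MDifferentiableAt 𝓘(ℝ, E) 𝓘(ℝ, ℝ) (fun y ↦ mvfderiv 𝓘(ℝ, E) f y (U y)) x := by
    intro U hU
    have := MDifferentiableAt.clm_bundle_apply (F₁ := E) (F₂ := ℝ)
      (E₁ := (TangentSpace 𝓘(ℝ, E) : M → Type _)) (E₂ := Bundle.Trivial M ℝ)
      ((contMDiff_mvfderiv hf).contMDiffAt.mdifferentiableAt (by simp)) hU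
    have h2 := (mdifferentiableAt_totalSpace 𝓘(ℝ, E) _).1 this
    simpa using h2.2
  -- the two fields and the function in the chart at `x`
  let hat (U : ∀ x : M, TangentSpace 𝓘(ℝ, E) x) : E → E :=
    VectorField.mpullbackWithin 𝓘(ℝ, E) 𝓘(ℝ, E) φ U (range 𝓘(ℝ, E))
  have hhat : ∀ {U : ∀ x : M, TangentSpace 𝓘(ℝ, E) x},
      MDifferentiableAt 𝓘(ℝ, E) (𝓘(ℝ, E).prod 𝓘(ℝ, E))
        (fun y ↦ (⟨y, U y⟩ : TotalSpace E (TangentSpace 𝓘(ℝ, E) : M → Type _))) x →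
      DifferentiableAt ℝ (hat U) c := by
    intro U hU
    have := (mdifferentiableWithinAt_univ.2 hU
      ).differentiableWithinAt_mpullbackWithin_vectorField
    have hs : (φ ⁻¹' univ ∩ range 𝓘(ℝ, E) : Set E) = univ := by simp
    have h2 : DifferentiableWithinAt ℝ (hat U) (φ ⁻¹' univ ∩ range 𝓘(ℝ, E)) c := this
    rwa [hs, differentiableWithinAt_univ] at h2
  have hhatc : ∀ U : ∀ x : M, TangentSpace 𝓘(ℝ, E) x, hat U c = U x := by
    intro U
    have h1 : hat U c = (mfderivWithin 𝓘(ℝ, E) 𝓘(ℝ, E) φ (range 𝓘(ℝ, E)) c).inverse (U (φ c)) := rfl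
    rw [h1, extChartAt_to_inv]
    exact mfderivWithin_extChartAt_symm_inverse_apply (U x)
  have hev : ∀ U : ∀ x : M, TangentSpace 𝓘(ℝ, E) x,
      ((fun y ↦ mvfderiv 𝓘(ℝ, E) f y (U y)) ∘ φ) =ᶠ[𝓝 c]
        fun y ↦ fderiv ℝ (f ∘ φ) y (hat U y) := by
    intro U
    filter_upwards [extChartAt_target_mem_nhds (I := 𝓘(ℝ, E)) x] with y hy
    have hinv := isInvertible_mfderivWithin_extChartAt_symm (I := 𝓘(ℝ, E)) hy
    have hU : mfderivWithin 𝓘(ℝ, E) 𝓘(ℝ, E) φ (range 𝓘(ℝ, E)) y (hat U y) = U (φ y) :=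
      hinv.self_apply_inverse _
    have hφy := mdifferentiableWithinAt_extChartAt_symm (I := 𝓘(ℝ, E)) hy
    have huniv : range 𝓘(ℝ, E) = univ := by simp
    rw [huniv] at hU hφy
    rw [mfderivWithin_univ] at hU
    rw [mdifferentiableWithinAt_univ] at hφy
    rw [Function.comp_apply, ← hU, ← mfderiv_eq_fderiv]
    rw [mfderiv_comp y (hf.mdifferentiableAt (by simp)) hφy]
    rfl
  have hf2 : ContDiffAt ℝ 2 (f ∘ φ) c := by
    have h1 : ContMDiffAt 𝓘(ℝ, E) 𝓘(ℝ, E) 2 φ c := by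
      have := contMDiffWithinAt_extChartAt_symm_range (I := 𝓘(ℝ, E)) (n := 2) x
        (mem_extChartAt_target (I := 𝓘(ℝ, E)) x)
      have huniv : range 𝓘(ℝ, E) = univ := by simp
      rwa [huniv, contMDiffWithinAt_univ] at this
    have h2 : ContMDiffAt 𝓘(ℝ, E) 𝓘(ℝ, ℝ) 2 (f ∘ φ) c :=
      ((hf.of_le two_le_infty) _).comp c h1
    exact contMDiffAt_iff_contDiffAt.1 h2
  have hfd : DifferentiableAt ℝ (fderiv ℝ (f ∘ φ)) c :=
    (hf2.fderiv_right (m := 1) (by norm_num)).differentiableAt (by simp)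
  have hder : ∀ {U : ∀ x : M, TangentSpace 𝓘(ℝ, E) x} (_ : DifferentiableAt ℝ (hat U) c) (v : E),
      fderiv ℝ ((fun y ↦ mvfderiv 𝓘(ℝ, E) f y (U y)) ∘ φ) c v
        = fderiv ℝ (fderiv ℝ (f ∘ φ)) c v (hat U c) + fderiv ℝ (f ∘ φ) c (fderiv ℝ (hat U) c v) := by
    intro U hU v
    rw [(hev U).fderiv_eq, fderiv_clm_apply hfd hU]
    simp [add_comm]
  have hbr : (VectorField.mlieBracket 𝓘(ℝ, E) V W x : E) =
      fderiv ℝ (hat W) c (hat V c) - fderiv ℝ (hat V) c (hat W c) := by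
    have hs : (φ ⁻¹' univ ∩ range 𝓘(ℝ, E) : Set E) = univ := by simp
    have h1 : (VectorField.mlieBracket 𝓘(ℝ, E) V W x : E) =
      (mfderiv 𝓘(ℝ, E) 𝓘(ℝ, E) (extChartAt 𝓘(ℝ, E) x) x).inverse
        (VectorField.lieBracketWithin (E := E) ℝ (hat V) (hat W) (φ ⁻¹' univ ∩ range 𝓘(ℝ, E)) c) := rfl
    rw [h1, hs, VectorField.lieBracketWithin_univ, mfderiv_extChartAt_self]
    exact DFunLike.congr_fun (ContinuousLinearMap.inverse_id (R := ℝ) (M := E)) _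
  have hsym : fderiv ℝ (fderiv ℝ (f ∘ φ)) c (hat V c) (hat W c)
      = fderiv ℝ (fderiv ℝ (f ∘ φ)) c (hat W c) (hat V c) :=
    (hf2.isSymmSndFDerivAt (by simp)) _ _
  rw [mvfderiv_eq_fderiv (hf.mdifferentiableAt (by simp)), mvfderiv_eq_fderiv (hdf hV),
    mvfderiv_eq_fderiv (hdf hW)]
  have e := congrArg (fderiv ℝ (f ∘ φ) c) hbr
  refine e.trans ?_
  have e1 := hder (hhat hW) (hat V c)
  have e2 := hder (hhat hV) (hat W c)
  rw [hhatc] at e1 e2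
  have e3 := congrArg₂ (· - ·) e1 e2
  refine Eq.trans ?_ e3.symm
  rw [map_sub]
  simp only [hhatc] at hsym ⊢
  rw [hsym]
  ring

omit [CompleteSpace E] in
/-- Near every point, the linear functionals of the chart are the restrictions of global smooth
functions. The differential is expressed in the trivialization of `TM` at the point. -/
lemma exists_contMDiff_mvfderiv_eventuallyEq [FiniteDimensional ℝ E] [T2Space M] (x₀ : M)
    (l : E →L[ℝ] ℝ) :
    ∃ f : M → ℝ, ContMDiff 𝓘(ℝ, E) 𝓘(ℝ, ℝ) ∞ f ∧
      ∀ᶠ y in 𝓝 x₀, ∀ v : TangentSpace 𝓘(ℝ, E) y, mvfderiv 𝓘(ℝ, E) f y v =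
        l ((trivializationAt E (TangentSpace 𝓘(ℝ, E) : M → Type _) x₀).continuousLinearMapAt ℝ
          y v) := by
  let ρ : SmoothBumpFunction 𝓘(ℝ, E) x₀ := Classical.arbitrary _
  have hl : ContMDiffOn 𝓘(ℝ, E) 𝓘(ℝ, ℝ) ∞ (fun y ↦ l (extChartAt 𝓘(ℝ, E) x₀ y))
      (chartAt E x₀).source :=
    l.contDiff.contMDiff.comp_contMDiffOn contMDiffOn_extChartAt
  refine ⟨fun y ↦ ρ y • l (extChartAt 𝓘(ℝ, E) x₀ y), ρ.contMDiff_smul hl, ?_⟩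
  filter_upwards [ρ.eventuallyEq_one.eventually_nhds,
    (chartAt E x₀).open_source.mem_nhds (mem_chart_source E x₀)] with y hy hys v
  have he : (fun y ↦ ρ y • l (extChartAt 𝓘(ℝ, E) x₀ y)) =ᶠ[𝓝 y]
      fun y ↦ l (extChartAt 𝓘(ℝ, E) x₀ y) := by
    filter_upwards [hy] with z hz
    rw [hz, Pi.one_apply, one_smul]
  rw [mvfderiv_congr he, TangentBundle.continuousLinearMapAt_trivializationAt hys]
  have hc := mfderiv_comp y (g := l) (I' := 𝓘(ℝ, E)) (I'' := 𝓘(ℝ, ℝ))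
    l.differentiableAt.mdifferentiableAt (mdifferentiableAt_extChartAt (I := 𝓘(ℝ, E)) hys)
  simp only [mvfderiv]
  change (mfderiv 𝓘(ℝ, E) 𝓘(ℝ, ℝ) (l ∘ extChartAt 𝓘(ℝ, E) x₀) y v : ℝ) = _
  rw [hc, mfderiv_eq_fderiv, l.fderiv]
  rfl

omit [CompleteSpace E] in
lemma exists_contMDiff_mvfderiv_eq [FiniteDimensional ℝ E] [T2Space M] {x : M}
    (α : CotangentSpace E x) :
    ∃ f : M → ℝ, ContMDiff 𝓘(ℝ, E) 𝓘(ℝ, ℝ) ∞ f ∧ mvfderiv 𝓘(ℝ, E) f x = α := by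
  obtain ⟨f, hf, he⟩ := exists_contMDiff_mvfderiv_eventuallyEq (E := E) x α
  refine ⟨f, hf, ContinuousLinearMap.ext fun v ↦ ?_⟩
  refine (he.self_of_nhds v).trans ?_
  rw [TangentBundle.continuousLinearMapAt_trivializationAt (mem_chart_source E x),
    mfderiv_extChartAt_self]
  rfl

end

/-! ### Poisson vector fields and Hamiltonian vector fields -/

section

variable {E : Type*} [NormedAddCommGroup E] [NormedSpace ℝ E] [FiniteDimensional ℝ E]
  {M : Type*} [TopologicalSpace M] [ChartedSpace E M] [IsManifold 𝓘(ℝ, E) ∞ M]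

namespace PoissonStructure

variable (P : PoissonStructure E M)

/-- The Lie derivative `(L_X Π)(α, β) = X(Π(α, β)) - Π(L_X α, β) - Π(α, L_X β)`. The Lie derivatives
of the 1-forms are expanded, so that it reads `α([#β, X]) - β([#α, X]) - X(Π(α, β))`. -/
def lieDerivBivector (X : ∀ x : M, TangentSpace 𝓘(ℝ, E) x) (α β : ∀ x : M, CotangentSpace E x)
    (x : M) : ℝ :=
  α x (VectorField.mlieBracket 𝓘(ℝ, E) (fun y ↦ P.sharp y (β y)) X x)
    - β x (VectorField.mlieBracket 𝓘(ℝ, E) (fun y ↦ P.sharp y (α y)) X x)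
    - mvfderiv 𝓘(ℝ, E) (fun y ↦ (β y (P.sharp y (α y)) : ℝ)) x (X x)

omit [FiniteDimensional ℝ E] in
lemma lieDerivBivector_skew (X : ∀ x : M, TangentSpace 𝓘(ℝ, E) x)
    (α β : ∀ x : M, CotangentSpace E x) (x : M) :
    P.lieDerivBivector X α β x = - P.lieDerivBivector X β α x := by
  have h : (fun y ↦ (β y (P.sharp y (α y)) : ℝ)) = -fun y ↦ (α y (P.sharp y (β y)) : ℝ) :=
    funext fun y ↦ P.skew y (α y) (β y)
  simp only [lieDerivBivector]
  rw [h, mvfderiv_neg]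
  simp only [_root_.neg_apply]
  ring

lemma tensorialAt_lieDerivBivector_right (X : ∀ x : M, TangentSpace 𝓘(ℝ, E) x)
    {α : ∀ x : M, CotangentSpace E x} {x : M}
    (hα : MDifferentiableAt 𝓘(ℝ, E) (𝓘(ℝ, E).prod 𝓘(ℝ, E →L[ℝ] ℝ))
      (fun y ↦ (⟨y, α y⟩ : CotangentBundle E M)) x) :
    TensorialAt 𝓘(ℝ, E) (E →L[ℝ] ℝ) (fun β ↦ P.lieDerivBivector X α β x) x where
  smul := by
    intro f β hf hβ
    have e1 : (fun y ↦ P.sharp y ((f • β) y)) = f • fun y ↦ P.sharp y (β y) :=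
      funext fun y ↦ map_smul (P.sharp y) (f y) (β y)
    have e2 : (fun y ↦ ((f • β) y (P.sharp y (α y)) : ℝ))
        = f * fun y ↦ (β y (P.sharp y (α y)) : ℝ) := rfl
    have e3 := VectorField.mlieBracket_smul_left (W := X) hf (mdiff_sharp P hβ)
    have e4 := mvfderiv_mul hf (mdiff_pair hβ (mdiff_sharp P hα))
    have hsk := P.skew x (α x) (β x)
    simp only [lieDerivBivector]
    rw [e1, e2, e3, e4]
    simp only [Pi.smul_apply', map_add, map_smul, _root_.add_apply, _root_.smul_apply, smul_eq_mul]
    change (β x (P.sharp x (α x)) : ℝ) = - (α x (P.sharp x (β x)) : ℝ) at hsk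
    rw [hsk]
    ring
  add := by
    intro β β' hβ hβ'
    have e1 : (fun y ↦ P.sharp y ((β + β') y))
        = (fun y ↦ P.sharp y (β y)) + fun y ↦ P.sharp y (β' y) :=
      funext fun y ↦ map_add (P.sharp y) (β y) (β' y)
    have e2 : (fun y ↦ ((β + β') y (P.sharp y (α y)) : ℝ))
        = (fun y ↦ (β y (P.sharp y (α y)) : ℝ)) + fun y ↦ (β' y (P.sharp y (α y)) : ℝ) := rfl
    have e3 := VectorField.mlieBracket_add_left (W := X) (mdiff_sharp P hβ) (mdiff_sharp P hβ')
    have e4 := mvfderiv_add (mdiff_pair hβ (mdiff_sharp P hα)) (mdiff_pair hβ' (mdiff_sharp P hα))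
    simp only [lieDerivBivector]
    rw [e1, e2, e3, e4]
    simp only [Pi.add_apply, map_add, _root_.add_apply]
    ring

lemma tensorialAt_lieDerivBivector_left (X : ∀ x : M, TangentSpace 𝓘(ℝ, E) x)
    {β : ∀ x : M, CotangentSpace E x} {x : M}
    (hβ : MDifferentiableAt 𝓘(ℝ, E) (𝓘(ℝ, E).prod 𝓘(ℝ, E →L[ℝ] ℝ))
      (fun y ↦ (⟨y, β y⟩ : CotangentBundle E M)) x) :
    TensorialAt 𝓘(ℝ, E) (E →L[ℝ] ℝ) (fun α ↦ P.lieDerivBivector X α β x) x where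
  smul := by
    intro f α hf hα
    have := (P.tensorialAt_lieDerivBivector_right X hβ).smul hf hα
    simp only [smul_eq_mul] at this ⊢
    rw [P.lieDerivBivector_skew, this, P.lieDerivBivector_skew X α β]
    ring
  add := by
    intro α α' hα hα'
    have := (P.tensorialAt_lieDerivBivector_right X hβ).add hα hα'
    rw [P.lieDerivBivector_skew, this, P.lieDerivBivector_skew X α β,
      P.lieDerivBivector_skew X α' β]
    ring

omit [FiniteDimensional ℝ E] in
lemma mdifferentiableAt_mvfderiv {f : M → ℝ} (hf : ContMDiff 𝓘(ℝ, E) 𝓘(ℝ, ℝ) ∞ f) (x : M) :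
    MDifferentiableAt 𝓘(ℝ, E) (𝓘(ℝ, E).prod 𝓘(ℝ, E →L[ℝ] ℝ))
      (fun y ↦ (⟨y, mvfderiv 𝓘(ℝ, E) f y⟩ : CotangentBundle E M)) x :=
  (contMDiff_mvfderiv hf).contMDiffAt.mdifferentiableAt (by simp)

/-- On exact forms the vanishing of `L_X Π` is the derivation property of `X` for the bracket. -/
lemma lieDerivBivector_mvfderiv {X : SmoothVectorField E M} (hX : X ∈ P.poissonFields)
    {f g : M → ℝ} (hf : ContMDiff 𝓘(ℝ, E) 𝓘(ℝ, ℝ) ∞ f) (hg : ContMDiff 𝓘(ℝ, E) 𝓘(ℝ, ℝ) ∞ g)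
    (x : M) :
    P.lieDerivBivector X (mvfderiv 𝓘(ℝ, E) f) (mvfderiv 𝓘(ℝ, E) g) x = 0 := by
  have hXd : MDifferentiableAt 𝓘(ℝ, E) (𝓘(ℝ, E).prod 𝓘(ℝ, E))
      (fun y ↦ (⟨y, X y⟩ : TotalSpace E (TangentSpace 𝓘(ℝ, E) : M → Type _))) x :=
    X.contMDiff.contMDiffAt.mdifferentiableAt (by simp)
  have e1 := mvfderiv_mlieBracket hf (mdiff_sharp P (mdifferentiableAt_mvfderiv hg x)) hXd
  have e2 := mvfderiv_mlieBracket hg (mdiff_sharp P (mdifferentiableAt_mvfderiv hf x)) hXd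
  have e3 := hX f g hf hg x
  have e4 : (fun y ↦ mvfderiv 𝓘(ℝ, E) f y (P.sharp y (mvfderiv 𝓘(ℝ, E) g y)))
      = -fun y ↦ mvfderiv 𝓘(ℝ, E) g y (P.sharp y (mvfderiv 𝓘(ℝ, E) f y)) :=
    funext fun y ↦ P.skew y (mvfderiv 𝓘(ℝ, E) g y) (mvfderiv 𝓘(ℝ, E) f y)
  have e5 := P.bracket_skew (lieDeriv X f) g x
  rw [e4, mvfderiv_neg] at e1
  rw [e5] at e3
  simp only [bracket, bracketOf, lieDeriv] at e3
  simp only [lieDerivBivector]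
  rw [e1, e2]
  simp only [_root_.neg_apply]
  change mvfderiv 𝓘(ℝ, E) (fun y ↦ mvfderiv 𝓘(ℝ, E) g y (P.sharp y (mvfderiv 𝓘(ℝ, E) f y))) x (X x)
    = -(mvfderiv 𝓘(ℝ, E) (fun y ↦ mvfderiv 𝓘(ℝ, E) f y (X y)) x
          (P.sharp x (mvfderiv 𝓘(ℝ, E) g x)))
      + mvfderiv 𝓘(ℝ, E) (fun y ↦ mvfderiv 𝓘(ℝ, E) g y (X y)) x
          (P.sharp x (mvfderiv 𝓘(ℝ, E) f x)) at e3
  linear_combination e3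

/-- `L_X Π = 0` for a Poisson vector field: by tensoriality it is enough to evaluate on
exact forms. -/
lemma lieDerivBivector_eq_zero [T2Space M] {X : SmoothVectorField E M} (hX : X ∈ P.poissonFields)
    {α β : ∀ x : M, CotangentSpace E x} {x : M}
    (hα : MDifferentiableAt 𝓘(ℝ, E) (𝓘(ℝ, E).prod 𝓘(ℝ, E →L[ℝ] ℝ))
      (fun y ↦ (⟨y, α y⟩ : CotangentBundle E M)) x)
    (hβ : MDifferentiableAt 𝓘(ℝ, E) (𝓘(ℝ, E).prod 𝓘(ℝ, E →L[ℝ] ℝ))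
      (fun y ↦ (⟨y, β y⟩ : CotangentBundle E M)) x) :
    P.lieDerivBivector X α β x = 0 := by
  obtain ⟨f, hf, hfα⟩ := exists_contMDiff_mvfderiv_eq (α x)
  obtain ⟨g, hg, hgβ⟩ := exists_contMDiff_mvfderiv_eq (β x)
  rw [← P.lieDerivBivector_mvfderiv hX hf hg x]
  exact TensorialAt.pointwise₂ (Φ := fun α β ↦ P.lieDerivBivector X α β x)
    (fun _ h ↦ P.tensorialAt_lieDerivBivector_left X h)
    (fun _ h ↦ P.tensorialAt_lieDerivBivector_right X h) hα (mdifferentiableAt_mvfderiv hf x)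
    hβ (mdifferentiableAt_mvfderiv hg x) hfα.symm hgβ.symm

/-- The torsion on a Poisson vector field, `T_∇(α, β)(X) = α(∇_{#β} X) - β(∇_{#α} X)`. -/
lemma torsion_eq_of_mem_poissonFields [T2Space M] (nabla : AffineConnection E M)
    {X : SmoothVectorField E M} (hX : X ∈ P.poissonFields) {x : M} (α β : CotangentSpace E x) :
    P.torsion nabla α β X = α (nabla X x (P.sharp x β)) - β (nabla X x (P.sharp x α)) := by
  have h := P.lieDerivBivector_eq_zero hX
    (FiberBundle.mdifferentiableAt_extend 𝓘(ℝ, E) (E →L[ℝ] ℝ) α)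
    (FiberBundle.mdifferentiableAt_extend 𝓘(ℝ, E) (E →L[ℝ] ℝ) β)
  simp only [lieDerivBivector] at h
  simp only [torsion, torsionForm, koszulBracket, covDerivForm, lieDerivForm]
  simp only [FiberBundle.extend_apply_self] at h ⊢
  linarith

/-- The Hamiltonian vector field `X_h = -#dh`. -/
def hamiltonianField {h : M → ℝ} (hh : ContMDiff 𝓘(ℝ, E) 𝓘(ℝ, ℝ) ∞ h) : SmoothVectorField E M where
  toFun x := - P.sharp x (mvfderiv 𝓘(ℝ, E) h x)
  contMDiff_toFun := by
    have := ContMDiff.clm_bundle_apply (F₁ := E →L[ℝ] ℝ) (F₂ := E)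
      (E₁ := (fun x : M ↦ CotangentSpace E x)) (E₂ := (TangentSpace 𝓘(ℝ, E) : M → Type _))
      P.contMDiff_sharp (contMDiff_mvfderiv hh)
    exact this.neg_section

omit [FiniteDimensional ℝ E] in
lemma hamiltonianField_apply {h : M → ℝ} (hh : ContMDiff 𝓘(ℝ, E) 𝓘(ℝ, ℝ) ∞ h) (x : M) :
    P.hamiltonianField hh x = - P.sharp x (mvfderiv 𝓘(ℝ, E) h x) := rfl

omit [FiniteDimensional ℝ E] in
/-- `⟨α, X_h⟩ = dh(#α)`. -/
lemma apply_hamiltonianField {h : M → ℝ} (hh : ContMDiff 𝓘(ℝ, E) 𝓘(ℝ, ℝ) ∞ h) {x : M}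
    (α : CotangentSpace E x) :
    α (P.hamiltonianField hh x) = mvfderiv 𝓘(ℝ, E) h x (P.sharp x α) := by
  rw [P.skew, hamiltonianField_apply, map_neg]

omit [FiniteDimensional ℝ E] in
lemma lieDeriv_hamiltonianField {h : M → ℝ} (hh : ContMDiff 𝓘(ℝ, E) 𝓘(ℝ, ℝ) ∞ h) (f : M → ℝ) :
    lieDeriv (P.hamiltonianField hh) f = fun x ↦ P.bracket f h x :=
  funext fun x ↦ P.apply_hamiltonianField hh (mvfderiv 𝓘(ℝ, E) f x)

/-- Hamiltonian vector fields are Poisson vector fields, by the Jacobi identity. -/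
lemma hamiltonianField_mem_poissonFields {h : M → ℝ} (hh : ContMDiff 𝓘(ℝ, E) 𝓘(ℝ, ℝ) ∞ h) :
    P.hamiltonianField hh ∈ P.poissonFields := by
  intro f g hf hg x
  have hj := P.jacobi f g h hf hg hh x
  have hs : P.bracket h f = fun y ↦ (-1 : ℝ) * P.bracket f h y :=
    funext fun y ↦ by rw [P.bracket_skew h f, neg_one_mul]
  have hfh : ContMDiff 𝓘(ℝ, E) 𝓘(ℝ, ℝ) ∞ (fun y ↦ P.bracket f h y) := by
    rw [← P.lieDeriv_hamiltonianField hh f]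
    exact contMDiff_lieDeriv _ hf
  have e1 := P.bracket_mul_left (-1) g hfh x
  rw [← hs] at e1
  rw [P.lieDeriv_hamiltonianField, P.lieDeriv_hamiltonianField, P.lieDeriv_hamiltonianField]
  change P.bracket (P.bracket f g) h x = _
  change P.bracket f (P.bracket g h) x + P.bracket g (P.bracket h f) x
    + P.bracket h (P.bracket f g) x = 0 at hj
  rw [P.bracket_skew g, e1, P.bracket_skew h] at hj
  linarith

end PoissonStructure

end

/-! ### The variation of the base paths -/

section

lemma hasDerivWithinAt_integral_of_continuousOn {k : ℝ → ℝ} (hk : ContinuousOn k unitInterval)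
    {t : ℝ} (ht : t ∈ unitInterval) :
    HasDerivWithinAt (fun r ↦ ∫ s in (0 : ℝ)..r, k s) (k t) unitInterval t := by
  have := Fact.mk ht
  refine intervalIntegral.integral_hasDerivWithinAt_right (s := unitInterval) (t := unitInterval)
    ((hk.mono (uIcc_subset_unitInterval ht)).intervalIntegrable)
    (hk.stronglyMeasurableAtFilter_nhdsWithin measurableSet_Icc t) (hk t ht)

lemma integral_eq_sub_of_hasDerivWithinAt {F k : ℝ → ℝ}
    (hF : ∀ s ∈ unitInterval, HasDerivWithinAt F (k s) unitInterval s)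
    (hk : ContinuousOn k unitInterval) {t : ℝ} (ht : t ∈ unitInterval) :
    ∫ s in (0 : ℝ)..t, k s = F t - F 0 := by
  have hsub : Icc 0 t ⊆ unitInterval := Icc_subset_Icc_right ht.2
  refine intervalIntegral.integral_eq_sub_of_hasDerivAt_of_le ht.1
    (fun s hs ↦ ((hF s (hsub hs)).continuousWithinAt).mono hsub) (fun s hs ↦ ?_)
    ((hk.mono (uIcc_subset_unitInterval ht)).intervalIntegrable)
  exact (hF s (hsub (Ioo_subset_Icc_self hs))).hasDerivAt
    (Icc_mem_nhds hs.1 (hs.2.trans_le ht.2))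

variable {E : Type*} [NormedAddCommGroup E] [NormedSpace ℝ E]
  {M : Type*} [TopologicalSpace M] [ChartedSpace E M]

lemma hasDerivWithinAt_comp_of_hasMFDerivWithinAt {f : M → ℝ}
    (hf : ContMDiff 𝓘(ℝ, E) 𝓘(ℝ, ℝ) ∞ f) {γ : ℝ → M} {s : Set ℝ} {t : ℝ}
    {v : TangentSpace 𝓘(ℝ, E) (γ t)}
    (h : HasMFDerivWithinAt 𝓘(ℝ, ℝ) 𝓘(ℝ, E) γ s t ((1 : ℝ →L[ℝ] ℝ).smulRight v)) :
    HasDerivWithinAt (fun r ↦ f (γ r)) (mvfderiv 𝓘(ℝ, E) f (γ t) v) s t := by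
  have h1 := (hf.mdifferentiableAt (x := γ t) (by simp)).hasMFDerivAt.comp_hasMFDerivWithinAt t h
  have e : ((mfderiv 𝓘(ℝ, E) 𝓘(ℝ, ℝ) f (γ t)).comp ((1 : ℝ →L[ℝ] ℝ).smulRight v) : ℝ →L[ℝ] ℝ)
      = (1 : ℝ →L[ℝ] ℝ).smulRight (mvfderiv 𝓘(ℝ, E) f (γ t) v) := by
    apply ContinuousLinearMap.ext_ring
    change mfderiv 𝓘(ℝ, E) 𝓘(ℝ, ℝ) f (γ t) ((1 : ℝ) • v)
      = (1 : ℝ) • (mvfderiv 𝓘(ℝ, E) f (γ t) v : ℝ)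
    rw [one_smul, one_smul]
    rfl
  have h2 : HasMFDerivWithinAt 𝓘(ℝ, ℝ) 𝓘(ℝ, ℝ) (fun r ↦ f (γ r)) s t
      ((1 : ℝ →L[ℝ] ℝ).smulRight (mvfderiv 𝓘(ℝ, E) f (γ t) v) : ℝ →L[ℝ] ℝ) := e ▸ h1
  exact hasDerivWithinAt_iff_hasFDerivWithinAt.2 (hasMFDerivWithinAt_iff_hasFDerivWithinAt.1 h2)

variable [IsManifold 𝓘(ℝ, E) ∞ M] [FiniteDimensional ℝ E]

lemma eq_zero_of_forall_mvfderiv_eq_zero [T2Space M] {x : M} {v : TangentSpace 𝓘(ℝ, E) x}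
    (h : ∀ f : M → ℝ, ContMDiff 𝓘(ℝ, E) 𝓘(ℝ, ℝ) ∞ f → mvfderiv 𝓘(ℝ, E) f x v = 0) : v = 0 := by
  refine SeparatingDual.eq_zero_of_forall_dual_eq_zero (R := ℝ) (V := E) fun l ↦ ?_
  obtain ⟨f, hf, hfl⟩ := exists_contMDiff_mvfderiv_eq (E := E) (x := x) l
  exact (DFunLike.congr_fun hfl v).symm.trans (h f hf)

section Family

variable {P : PoissonStructure E M} {nabla : AffineConnection E M}
  {c : ℝ → ℝ → CovectorPair E M}

/-- The difference `∂_ε γ - #b` for a family `c = (γ, a, b)`. -/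
def defect (P : PoissonStructure E M) (c : ℝ → ℝ → CovectorPair E M) (ε t : ℝ) :
    TangentSpace 𝓘(ℝ, E) (c ε t).1 :=
  velocity (E := E) (fun e ↦ (c e t).1) ε - P.sharp (c ε t).1 (c ε t).2.2

lemma FamilyAt.hasMFDerivWithinAt_left {ε t : ℝ} (h : FamilyAt P nabla c ε t)
    (hε : ε ∈ unitInterval) (ht : t ∈ unitInterval) :
    HasMFDerivWithinAt 𝓘(ℝ, ℝ) 𝓘(ℝ, E) (fun e ↦ (c e t).1) unitInterval ε
      ((1 : ℝ →L[ℝ] ℝ).smulRight (velocity (E := E) (fun e ↦ (c e t).1) ε)) := by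
  obtain ⟨w, hw, -⟩ := h.exists_derivs hε ht
  rwa [velocity_eq hε hw]

/-- For a Poisson vector field the variation equation reads
`∂_ε⟨a, X⟩ - ∂_t⟨b, X⟩ = ⟨a, ∇_w X⟩` with `w = ∂_ε γ - #b`. -/
lemma FamilyAt.hasDerivWithinAt_pair [T2Space M] {ε t : ℝ} (h : FamilyAt P nabla c ε t)
    (hε : ε ∈ unitInterval) (ht : t ∈ unitInterval) {X : SmoothVectorField E M}
    (hX : X ∈ P.poissonFields) :
    HasDerivWithinAt (fun s ↦ ((c ε s).2.2 (X (c ε s).1) : ℝ))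
      (derivWithin (fun e ↦ ((c e t).2.1 (X (c e t).1) : ℝ)) unitInterval ε
        - (c ε t).2.1 (nabla X (c ε t).1 (defect P c ε t))) unitInterval t := by
  obtain ⟨w, hw, hY⟩ := h.exists_derivs hε ht
  obtain ⟨f, g, hf, hg, e⟩ := hY X
  rw [P.torsion_eq_of_mem_poissonFields nabla hX] at e
  refine hf.congr_deriv ?_
  rw [hg.derivWithin (uniqueDiffOn_Icc_zero_one.uniqueDiffWithinAt hε), defect, velocity_eq hε hw,
    map_sub, map_sub]
  linear_combination e

lemma contDiffOn_pair
    (hc : ∀ ε ∈ unitInterval, ∀ t ∈ unitInterval, FamilyAt P nabla c ε t)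
    (X : SmoothVectorField E M) :
    ContDiffOn ℝ 1 (fun z : ℝ × ℝ ↦ ((c z.1 z.2).2.1 (X (c z.1 z.2).1) : ℝ))
      (unitInterval ×ˢ unitInterval) := fun z hz ↦
  contDiffWithinAt_pair (g := fun z : ℝ × ℝ ↦ (c z.1 z.2).toBundle)
    (hc z.1 hz.1 z.2 hz.2).smooth X

/-- The commutation of `∂_ε` and `∂_t` on `f(γ)`: since `∂_t f(γ) = ⟨a, X_f⟩`, the derivative
of `∂_ε f(γ)` in `t` is `∂_ε⟨a, X_f⟩`. -/
lemma hasDerivWithinAt_mvfderiv_velocity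
    (hc : ∀ ε ∈ unitInterval, ∀ t ∈ unitInterval, FamilyAt P nabla c ε t) {x : M}
    (h₀ : ∀ ε ∈ unitInterval, (c ε 0).1 = x) {f : M → ℝ}
    (hf : ContMDiff 𝓘(ℝ, E) 𝓘(ℝ, ℝ) ∞ f) {ε t : ℝ} (hε : ε ∈ Ioo (0 : ℝ) 1)
    (ht : t ∈ unitInterval) :
    HasDerivWithinAt
      (fun s ↦ mvfderiv 𝓘(ℝ, E) f (c ε s).1 (velocity (E := E) (fun e ↦ (c e s).1) ε))
      (derivWithin (fun e ↦ ((c e t).2.1 (P.hamiltonianField hf (c e t).1) : ℝ)) unitInterval ε)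
      unitInterval t := by
  have hh := contDiffOn_pair hc (P.hamiltonianField hf)
  have hε' : ε ∈ unitInterval := Ioo_subset_Icc_self hε
  have hF : ∀ e ∈ unitInterval, ∀ s ∈ unitInterval, f (c e s).1
      = f x + ∫ r in (0 : ℝ)..s, ((c e r).2.1 (P.hamiltonianField hf (c e r).1) : ℝ) := by
    intro e he s hs
    rw [integral_eq_sub_of_hasDerivWithinAt (F := fun r ↦ f (c e r).1) ?_
      (continuousOn_slice hh.continuousOn he) hs, h₀ e he]
    · ring
    · intro r hr
      rw [P.apply_hamiltonianField]
      exact hasDerivWithinAt_comp_of_hasMFDerivWithinAt hf (hc e he r hr).vel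
  have hv : ∀ s ∈ unitInterval,
      mvfderiv 𝓘(ℝ, E) f (c ε s).1 (velocity (E := E) (fun e ↦ (c e s).1) ε)
        = ∫ r in (0 : ℝ)..s, derivWithin
          (fun e ↦ ((c e r).2.1 (P.hamiltonianField hf (c e r).1) : ℝ)) unitInterval ε := by
    intro s hs
    have h1 := hasDerivWithinAt_comp_of_hasMFDerivWithinAt hf
      ((hc ε hε' s hs).hasMFDerivWithinAt_left hε' hs)
    have h2 := ((hasDerivAt_integral_slice hh hε hs).const_add (f x)).hasDerivWithinAt
      (s := unitInterval)
    have h3 := h2.congr (fun e he ↦ hF e he s hs) (hF ε hε' s hs)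
    exact (uniqueDiffOn_Icc_zero_one.uniqueDiffWithinAt hε').eq_deriv _ h1 h3
  exact (hasDerivWithinAt_integral_of_continuousOn
    (continuousOn_slice (continuousOn_derivWithin_slice hh) hε') ht).congr hv (hv t ht)

/-- The equation `∂_t df(w) = ⟨a, ∇_w X_f⟩` for `w = ∂_ε γ - #b`: a linear differential equation
for `w`, since `f` is arbitrary. -/
lemma hasDerivWithinAt_mvfderiv_defect [T2Space M]
    (hc : ∀ ε ∈ unitInterval, ∀ t ∈ unitInterval, FamilyAt P nabla c ε t) {x : M}
    (h₀ : ∀ ε ∈ unitInterval, (c ε 0).1 = x) {f : M → ℝ}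
    (hf : ContMDiff 𝓘(ℝ, E) 𝓘(ℝ, ℝ) ∞ f) {ε t : ℝ} (hε : ε ∈ Ioo (0 : ℝ) 1)
    (ht : t ∈ unitInterval) :
    HasDerivWithinAt (fun s ↦ mvfderiv 𝓘(ℝ, E) f (c ε s).1 (defect P c ε s))
      ((c ε t).2.1 (nabla (P.hamiltonianField hf) (c ε t).1 (defect P c ε t))) unitInterval t := by
  have hε' : ε ∈ unitInterval := Ioo_subset_Icc_self hε
  have h1 := hasDerivWithinAt_mvfderiv_velocity hc h₀ hf hε ht
  have h2 := (hc ε hε' t ht).hasDerivWithinAt_pair hε' ht (P.hamiltonianField_mem_poissonFields hf)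
  refine ((h1.sub h2).congr_deriv (by ring)).congr_of_eventuallyEq ?_ ?_
  · refine Filter.Eventually.of_forall fun s ↦ ?_
    simp only [defect, map_sub, Pi.sub_apply, P.apply_hamiltonianField]
  · simp only [defect, map_sub, Pi.sub_apply, P.apply_hamiltonianField]

lemma defect_zero {x : M} (h₀ : ∀ ε ∈ unitInterval, (c ε 0).1 = x ∧ (c ε 0).2.2 = 0) {ε : ℝ}
    (hε : ε ∈ unitInterval) : defect P c ε 0 = 0 := by
  have h1 : HasMFDerivWithinAt 𝓘(ℝ, ℝ) 𝓘(ℝ, E) (fun e ↦ (c e 0).1) unitInterval ε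
      ((1 : ℝ →L[ℝ] ℝ).smulRight (0 : TangentSpace 𝓘(ℝ, E) (c ε 0).1)) := by
    have h := hasMFDerivWithinAt_const (I := 𝓘(ℝ, ℝ)) (I' := 𝓘(ℝ, E)) (c ε 0).1 unitInterval ε
    have h' := h.congr_of_eventuallyEq (f₁ := fun e ↦ (c e 0).1) ?_ rfl
    · have e0 : ((1 : ℝ →L[ℝ] ℝ).smulRight (0 : TangentSpace 𝓘(ℝ, E) (c ε 0).1) : ℝ →L[ℝ] E) = 0 :=
        ContinuousLinearMap.ext_ring (smul_zero (1 : ℝ))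
      exact e0 ▸ h'
    · filter_upwards [self_mem_nhdsWithin] with e he
      rw [(h₀ e he).1, (h₀ ε hε).1]
  rw [defect, velocity_eq hε h1, (h₀ ε hε).2]
  exact (zero_sub _).trans (neg_eq_zero.2 (map_zero _))

end Family

end

/-! ### Uniqueness for the variation, and homotopy invariance -/

section

variable {E : Type*} [NormedAddCommGroup E] [NormedSpace ℝ E] [FiniteDimensional ℝ E]
  {M : Type*} [TopologicalSpace M] [ChartedSpace E M] [IsManifold 𝓘(ℝ, E) ∞ M]
  {P : PoissonStructure E M} {nabla : AffineConnection E M}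
  {c : ℝ → ℝ → CovectorPair E M}

omit [FiniteDimensional ℝ E] in
/-- The functions `⟨a, ∇_e X⟩` along a path, for a local frame field `e`, are continuous. -/
lemma continuousWithinAt_apply_nabla_localFrame
    [CovariantDerivative.ContMDiffCovariantDerivative nabla ∞]
    {a : ℝ → CotangentBundle E M} {s : Set ℝ} {t : ℝ}
    (ha : ContMDiffWithinAt 𝓘(ℝ, ℝ) (𝓘(ℝ, E).prod 𝓘(ℝ, E →L[ℝ] ℝ)) 1 a s t)
    (X : SmoothVectorField E M) {ι : Type*} (v : Module.Basis ι ℝ E) (i : ι) :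
    ContinuousWithinAt (fun r ↦ ((a r).2 (nabla X (a r).proj
      ((trivializationAt E (TangentSpace 𝓘(ℝ, E) : M → Type _) (a t).proj).localFrame v i
        (a r).proj)) : ℝ)) s t := by
  set e := trivializationAt E (TangentSpace 𝓘(ℝ, E) : M → Type _) (a t).proj
  have hb : ContMDiffWithinAt 𝓘(ℝ, ℝ) 𝓘(ℝ, E) 1 (fun r ↦ (a r).proj) s t :=
    (contMDiffWithinAt_totalSpace.1 ha).1
  have he : ContMDiffWithinAt 𝓘(ℝ, ℝ) (𝓘(ℝ, E).prod 𝓘(ℝ, E)) 1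
      (fun r ↦ (⟨(a r).proj, e.localFrame v i (a r).proj⟩ :
        TotalSpace E (TangentSpace 𝓘(ℝ, E) : M → Type _))) s t :=
    (contMDiffAt_localFrame_of_mem (I := 𝓘(ℝ, E)) 1 e v i
      (FiberBundle.mem_baseSet_trivializationAt' (a t).proj)).comp_contMDiffWithinAt t hb
  have hnX : ContMDiff 𝓘(ℝ, E) (𝓘(ℝ, E).prod 𝓘(ℝ, E →L[ℝ] E)) 1
      (fun y ↦ (⟨y, nabla X y⟩ : TotalSpace (E →L[ℝ] E)
        (fun y : M ↦ TangentSpace 𝓘(ℝ, E) y →L[ℝ] TangentSpace 𝓘(ℝ, E) y))) :=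
    (contMDiffOn_univ.1
      ((CovariantDerivative.ContMDiffCovariantDerivative.contMDiff (cov := nabla) (k := ∞)).contMDiff
        (σ := X) X.contMDiff.contMDiffOn)).of_le (by simp)
  have h1 := ContMDiffWithinAt.clm_bundle_apply (F₁ := E) (F₂ := E)
    (E₁ := (TangentSpace 𝓘(ℝ, E) : M → Type _)) (E₂ := (TangentSpace 𝓘(ℝ, E) : M → Type _))
    (b := fun r ↦ (a r).proj) (ϕ := fun r ↦ nabla X (a r).proj)
    ((hnX (a t).proj).comp_contMDiffWithinAt t hb) he
  have h2 := ContMDiffWithinAt.clm_bundle_apply (F₁ := E) (F₂ := ℝ)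
    (E₁ := (TangentSpace 𝓘(ℝ, E) : M → Type _)) (E₂ := Bundle.Trivial M ℝ)
    (b := fun r ↦ (a r).proj) (ϕ := fun r ↦ (a r).2) ha h1
  exact (contMDiffWithinAt_totalSpace.1 h2).2.continuousWithinAt

/-- Local uniqueness for the linear differential equation of `w = ∂_ε γ - #b`. -/
lemma eventually_defect_eq_zero [T2Space M]
    [CovariantDerivative.ContMDiffCovariantDerivative nabla ∞]
    (hc : ∀ ε ∈ unitInterval, ∀ t ∈ unitInterval, FamilyAt P nabla c ε t) {x : M}
    (h₀ : ∀ ε ∈ unitInterval, (c ε 0).1 = x) {ε t : ℝ} (hε : ε ∈ Ioo (0 : ℝ) 1)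
    (ht : t ∈ Ico (0 : ℝ) 1) (hz : defect P c ε t = 0) :
    ∀ᶠ s in 𝓝[>] t, defect P c ε s = 0 := by
  have hε' : ε ∈ unitInterval := Ioo_subset_Icc_self hε
  have ht' : t ∈ unitInterval := Ico_subset_Icc_self ht
  have ha : ContMDiffWithinAt 𝓘(ℝ, ℝ) (𝓘(ℝ, E).prod 𝓘(ℝ, E →L[ℝ] ℝ)) 1
      (fun s ↦ (c ε s).toBundle) unitInterval t :=
    contMDiffWithinAt_slice_right (g := fun e s ↦ (c e s).toBundle) hε' (hc ε hε' t ht').smooth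
  set e := trivializationAt E (TangentSpace 𝓘(ℝ, E) : M → Type _) (c ε t).1 with he
  let v := Module.finBasis ℝ E
  -- functions whose differentials near `γ(t)` are the coordinates in the frame `e_j`
  choose f hf hfe using fun i ↦
    exists_contMDiff_mvfderiv_eventuallyEq (c ε t).1 (v.coord i).toContinuousLinearMap
  let u : ℝ → Fin (Module.finrank ℝ E) → ℝ := fun s i ↦
    mvfderiv 𝓘(ℝ, E) (f i) (c ε s).1 (defect P c ε s)
  let K : Fin (Module.finrank ℝ E) → Fin (Module.finrank ℝ E) → ℝ → ℝ := fun i j s ↦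
    (c ε s).2.1 (nabla (P.hamiltonianField (hf i)) (c ε s).1 (e.localFrame v j (c ε s).1))
  have hu : ∀ s ∈ unitInterval, HasDerivWithinAt u (fun i ↦
      ((c ε s).2.1 (nabla (P.hamiltonianField (hf i)) (c ε s).1 (defect P c ε s)) : ℝ))
      unitInterval s := fun s hs ↦
    hasDerivWithinAt_pi.2 fun i ↦ hasDerivWithinAt_mvfderiv_defect hc h₀ (hf i) hε hs
  have hK : ContinuousWithinAt (fun s ↦ ∑ i, ∑ j, |K i j s|) unitInterval t := by
    refine tendsto_finsetSum _ fun i _ ↦ tendsto_finsetSum _ fun j _ ↦ ?_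
    exact (continuousWithinAt_apply_nabla_localFrame (nabla := nabla) ha
      (P.hamiltonianField (hf i)) v j).abs
  have hγ : ContinuousWithinAt (fun s ↦ (c ε s).1) unitInterval t :=
    (contMDiffWithinAt_totalSpace.1 ha).1.continuousWithinAt
  set C := ∑ i, ∑ j, |K i j t| + 1 with hC
  -- near `t` the defect is determined by `u`, and the equation has bounded coefficients
  have hev : ∀ᶠ s in 𝓝[unitInterval] t, (∑ i, ∑ j, |K i j s| ≤ C) ∧
      defect P c ε s = ∑ j, u s j • e.localFrame v j (c ε s).1 := by
    have h1 := hK.eventually (ge_mem_nhds (show ∑ i, ∑ j, |K i j t| < C by rw [hC]; linarith))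
    have h2 := hγ.eventually (Filter.eventually_all.2 hfe)
    have h3 := hγ.eventually (e.open_baseSet.mem_nhds
      (FiberBundle.mem_baseSet_trivializationAt' (c ε t).1))
    filter_upwards [h1, h2, h3] with s hs1 hs2 hs3
    refine ⟨hs1, ?_⟩
    have hr := ((e.basisAt v hs3).sum_repr (defect P c ε s)).symm
    rw [hr]
    refine Finset.sum_congr rfl fun j _ ↦ ?_
    rw [e.localFrame_apply_of_mem_baseSet v hs3]
    congr 1
    change _ = mvfderiv 𝓘(ℝ, E) (f j) (c ε s).1 (defect P c ε s)
    rw [hs2 j]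
    change v.repr (e.linearEquivAt ℝ (c ε s).1 hs3 (defect P c ε s)) j = _
    rw [Bundle.Trivialization.continuousLinearMapAt_apply,
      Bundle.Trivialization.coe_linearMapAt_of_mem _ hs3]
    rfl
  have hev' : ∀ᶠ s in 𝓝[≥] t, s ∈ unitInterval ∧ (∑ i, ∑ j, |K i j s| ≤ C) ∧
      defect P c ε s = ∑ j, u s j • e.localFrame v j (c ε s).1 := by
    have hI : unitInterval ∈ 𝓝[≥] t :=
      Filter.mem_of_superset (Icc_mem_nhdsGE ht.2) (Icc_subset_Icc_left ht.1)
    exact (Filter.eventually_mem_set.2 hI).and (nhdsWithin_le_of_mem hI hev)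
  obtain ⟨δ, hδ, hsub⟩ := mem_nhdsGE_iff_exists_Icc_subset.1 hev'
  have hu0 : u t = 0 := by
    funext i
    change mvfderiv 𝓘(ℝ, E) (f i) (c ε t).1 (defect P c ε t) = 0
    rw [hz, map_zero]
  have huz := eq_zero_of_abs_deriv_le_mul_abs_self_of_eq_zero_right (f := u) (K := C) (a := t)
    (b := δ) (fun s hs ↦ ((hu s (hsub hs).1).continuousWithinAt).mono fun r hr ↦ (hsub hr).1)
    (f' := fun s i ↦
      ((c ε s).2.1 (nabla (P.hamiltonianField (hf i)) (c ε s).1 (defect P c ε s)) : ℝ))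
    ?_ hu0 ?_
  · filter_upwards [Ioc_mem_nhdsGT hδ] with s hs
    have hs' := Ioc_subset_Icc_self hs
    rw [(hsub hs').2.2, huz s hs']
    simp
  · intro s hs
    refine (hu s (hsub (Ico_subset_Icc_self hs)).1).mono_of_mem_nhdsWithin ?_
    exact Filter.mem_of_superset (Icc_mem_nhdsGE hs.2) fun r hr ↦ (hsub ⟨hs.1.trans hr.1, hr.2⟩).1
  · intro s hs
    obtain ⟨-, h1, h2⟩ := hsub (Ico_subset_Icc_self hs)
    have hC0 : 0 ≤ C := le_trans (by positivity) h1
    refine (pi_norm_le_iff_of_nonneg (by positivity)).2 fun i ↦ ?_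
    calc ‖((c ε s).2.1 (nabla (P.hamiltonianField (hf i)) (c ε s).1 (defect P c ε s)) : ℝ)‖
        = ‖∑ j, u s j * K i j s‖ := by
          rw [h2]
          simp only [map_sum, map_smul, smul_eq_mul, K]
      _ ≤ ∑ j, ‖u s j * K i j s‖ := norm_sum_le _ _
      _ ≤ ∑ j, ‖u s‖ * |K i j s| := by
          refine Finset.sum_le_sum fun j _ ↦ ?_
          rw [norm_mul, Real.norm_eq_abs (K i j s)]
          exact mul_le_mul_of_nonneg_right (norm_le_pi_norm (u s) j) (abs_nonneg _)
      _ = (∑ j, |K i j s|) * ‖u s‖ := by rw [← Finset.mul_sum, mul_comm]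
      _ ≤ C * ‖u s‖ := by
          refine mul_le_mul_of_nonneg_right (le_trans ?_ h1) (norm_nonneg _)
          exact Finset.single_le_sum (f := fun i ↦ ∑ j, |K i j s|)
            (fun i _ ↦ Finset.sum_nonneg fun j _ ↦ abs_nonneg _) (Finset.mem_univ i)

/-- In a family with fixed initial point and `b(ε, 0) = 0` one has `∂_ε γ = #b` for `0 < ε < 1`. -/
lemma defect_eq_zero [T2Space M] [CovariantDerivative.ContMDiffCovariantDerivative nabla ∞]
    (hc : ∀ ε ∈ unitInterval, ∀ t ∈ unitInterval, FamilyAt P nabla c ε t) {x : M}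
    (h₀ : ∀ ε ∈ unitInterval, (c ε 0).1 = x ∧ (c ε 0).2.2 = 0) {ε t : ℝ}
    (hε : ε ∈ Ioo (0 : ℝ) 1) (ht : t ∈ unitInterval) : defect P c ε t = 0 := by
  have h₀' : ∀ ε ∈ unitInterval, (c ε 0).1 = x := fun e he ↦ (h₀ e he).1
  refine IsClosed.Icc_subset_of_forall_mem_nhdsWithin (s := {t | defect P c ε t = 0}) ?_
    (defect_zero h₀ (Ioo_subset_Icc_self hε))
    (fun s hs ↦ eventually_defect_eq_zero hc h₀' hε hs.2 hs.1) ht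
  have e : {t | defect P c ε t = 0} ∩ Icc 0 1
      = ⋂ f : {f : M → ℝ // ContMDiff 𝓘(ℝ, E) 𝓘(ℝ, ℝ) ∞ f},
        Icc 0 1 ∩ (fun s ↦ mvfderiv 𝓘(ℝ, E) f.1 (c ε s).1 (defect P c ε s)) ⁻¹' {0} := by
    ext s
    simp only [mem_inter_iff, mem_ofPred_eq, mem_iInter, mem_preimage, mem_singleton_iff]
    refine ⟨fun h f ↦ ⟨h.2, by rw [h.1, map_zero]⟩, fun h ↦ ⟨?_, ?_⟩⟩
    · exact eq_zero_of_forall_mvfderiv_eq_zero fun f hf ↦ (h ⟨f, hf⟩).2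
    · exact (h ⟨fun _ ↦ 0, contMDiff_const⟩).1
  rw [e]
  refine isClosed_iInter fun f ↦ ?_
  exact ContinuousOn.preimage_isClosed_of_isClosed (fun s hs ↦
    (hasDerivWithinAt_mvfderiv_defect hc h₀' f.2 hε hs).continuousWithinAt) isClosed_Icc
    isClosed_singleton

/-- The integral of a Poisson vector field is constant along a cotangent homotopy: its
`ε`-derivative is `∫ ∂_t⟨b, X⟩ dt = 0`. -/
lemma CotangentPath.Homotopic.integral_eq [T2Space M]
    [CovariantDerivative.ContMDiffCovariantDerivative nabla ∞] {a₀ a₁ : CotangentPath P}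
    (h : a₀.Homotopic nabla a₁) {X : SmoothVectorField E M} (hX : X ∈ P.poissonFields) :
    a₀.integral X = a₁.integral X := by
  obtain ⟨c, hc, h0, h1, hl, hr⟩ := h.exists_family
  have hh := contDiffOn_pair hc X
  have hd : ∀ ε ∈ Ioo (0 : ℝ) 1,
      HasDerivAt (fun e ↦ ∫ s in (0 : ℝ)..1, ((c e s).2.1 (X (c e s).1) : ℝ)) 0 ε := by
    intro ε hε
    have hε' : ε ∈ unitInterval := Ioo_subset_Icc_self hε
    refine (hasDerivAt_integral_slice hh hε unitInterval.one_mem).congr_deriv ?_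
    rw [integral_eq_sub_of_hasDerivWithinAt (F := fun s ↦ ((c ε s).2.2 (X (c ε s).1) : ℝ)) ?_
      (continuousOn_slice (continuousOn_derivWithin_slice hh) hε') unitInterval.one_mem,
      (h0 ε hε').2, (h1 ε hε').2]
    · exact sub_self _
    · intro s hs
      have hb := (hc ε hε' s hs).hasDerivWithinAt_pair hε' hs hX
      rwa [defect_eq_zero hc h0 hε hs, map_zero, map_zero, sub_zero] at hb
  obtain ⟨ε, -, e⟩ := exists_hasDerivAt_eq_slope _ _ zero_lt_one
    (continuousOn_integral_slice hh.continuousOn) hd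
  have e0 : a₀.integral X = ∫ s in (0 : ℝ)..1, ((c 0 s).2.1 (X (c 0 s).1) : ℝ) := by
    refine intervalIntegral.integral_congr fun s hs ↦ ?_
    rw [← hl s (uIcc_subset_unitInterval unitInterval.one_mem hs)]
    rfl
  have e1 : a₁.integral X = ∫ s in (0 : ℝ)..1, ((c 1 s).2.1 (X (c 1 s).1) : ℝ) := by
    refine intervalIntegral.integral_congr fun s hs ↦ ?_
    rw [← hr s (uIcc_subset_unitInterval unitInterval.one_mem hs)]
    rfl
  rw [e0, e1]
  simp only [sub_zero, div_one] at e
  linarith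

end

/-! ### The homomorphism to the dual of the first Poisson cohomology -/

section

variable {E : Type*} [NormedAddCommGroup E] [NormedSpace ℝ E] [FiniteDimensional ℝ E]
  {M : Type*} [TopologicalSpace M] [ChartedSpace E M] [IsManifold 𝓘(ℝ, E) ∞ M]
  {P : PoissonStructure E M}

namespace CotangentPath

lemma continuousOn_pair (a : CotangentPath P) (X : SmoothVectorField E M) :
    ContinuousOn (fun t ↦ ((a t).2 (X (a t).proj) : ℝ)) unitInterval :=
  fun t ht ↦ (contDiffWithinAt_pair (a.contMDiffOn t ht) X).continuousWithinAt

lemma intervalIntegrable_pair (a : CotangentPath P) (X : SmoothVectorField E M) {s t : ℝ}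
    (hs : s ∈ unitInterval) (ht : t ∈ unitInterval) :
    IntervalIntegrable (fun t ↦ ((a t).2 (X (a t).proj) : ℝ)) volume s t :=
  ((a.continuousOn_pair X).mono (ordConnected_Icc.uIcc_subset hs ht)).intervalIntegrable

lemma integral_add (a : CotangentPath P) (X Y : SmoothVectorField E M) :
    a.integral (X + Y : SmoothVectorField E M) = a.integral X + a.integral Y := by
  refine Eq.trans ?_ (intervalIntegral.integral_add
    (a.intervalIntegrable_pair X unitInterval.zero_mem unitInterval.one_mem)
    (a.intervalIntegrable_pair Y unitInterval.zero_mem unitInterval.one_mem))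
  exact intervalIntegral.integral_congr fun t _ ↦ map_add (a t).2 (X (a t).proj) (Y (a t).proj)

omit [FiniteDimensional ℝ E] in
lemma integral_smul (a : CotangentPath P) (r : ℝ) (X : SmoothVectorField E M) :
    a.integral (r • X : SmoothVectorField E M) = r * a.integral X := by
  refine Eq.trans ?_ (intervalIntegral.integral_const_mul r _)
  exact intervalIntegral.integral_congr fun t _ ↦ map_smul (a t).2 r (X (a t).proj)

/-- The integral of a Hamiltonian vector field `X_h` along `a` is the variation of `h` along the
base path. -/
lemma integral_hamiltonianField (a : CotangentPath P) {h : M → ℝ}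
    (hh : ContMDiff 𝓘(ℝ, E) 𝓘(ℝ, ℝ) ∞ h) :
    a.integral (P.hamiltonianField hh) = h (a 1).proj - h (a 0).proj := by
  refine integral_eq_sub_of_hasDerivWithinAt (F := fun t ↦ h (a t).proj) (fun t ht ↦ ?_)
    (a.continuousOn_pair _) unitInterval.one_mem
  rw [P.apply_hamiltonianField]
  exact hasDerivWithinAt_comp_of_hasMFDerivWithinAt hh (a.hasMFDerivWithinAt t ht)

/-- Change of variables in the integral along a cotangent path. -/
lemma integral_reparam (a : CotangentPath P) (X : SmoothVectorField E M) {q : ℝ → ℝ}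
    (hq : ContDiff ℝ 2 q) (hm : ∀ t, q t ∈ unitInterval) (s t : ℝ) :
    ∫ r in s..t, ((reparam q a r).2 (X (reparam q a r).proj) : ℝ)
      = ∫ u in q s..q t, ((a u).2 (X (a u).proj) : ℝ) := by
  rw [← intervalIntegral.integral_comp_mul_deriv' (f := q) (f' := deriv q)
    (fun r _ ↦ (hq.differentiable (by simp)).differentiableAt.hasDerivAt)
    (hq.continuous_deriv (by simp)).continuousOn
    ((a.continuousOn_pair X).mono (by rintro _ ⟨r, -, rfl⟩; exact hm r))]
  refine intervalIntegral.integral_congr fun r _ ↦ ?_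
  exact mul_comm _ _

end CotangentPath

namespace CotangentLoop

variable {x : M}

/-- Hamiltonian vector fields integrate to `0` along loops. -/
lemma integral_eq_zero (a : CotangentLoop P x) {X : SmoothVectorField E M}
    (hX : X ∈ P.hamiltonianFields) : a.integral X = 0 := by
  obtain ⟨h, hh, e⟩ := hX
  obtain rfl : X = P.hamiltonianField hh := ContMDiffSection.ext e
  rw [a.integral_hamiltonianField hh]
  rw [a.source, a.target, sub_self]

lemma integral_trans (a b : CotangentLoop P x) (X : SmoothVectorField E M) :
    (a.trans b).integral X = a.integral X + b.integral X := by
  have half_mem : (1 / 2 : ℝ) ∈ unitInterval := by constructor <;> norm_num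
  have ha := a.toCotangentPath.integral_reparam X contDiff_firstHalf firstHalf_mem 0 (1 / 2)
  have hb := b.toCotangentPath.integral_reparam X contDiff_secondHalf secondHalf_mem (1 / 2) 1
  rw [firstHalf_zero, firstHalf_eq_one (by norm_num)] at ha
  rw [secondHalf_one, secondHalf_eq_zero (by norm_num)] at hb
  refine (intervalIntegral.integral_add_adjacent_intervals
    ((a.trans b).intervalIntegrable_pair X unitInterval.zero_mem half_mem)
    ((a.trans b).intervalIntegrable_pair X half_mem unitInterval.one_mem)).symm.trans ?_
  refine congrArg₂ (· + ·) (Eq.trans ?_ ha) (Eq.trans ?_ hb)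
  · refine intervalIntegral.integral_congr fun t ht ↦ ?_
    rw [uIcc_of_le (by norm_num)] at ht
    have e : (a.trans b).toFun t = reparam firstHalf a.toCotangentPath t := if_pos ht.2
    rw [e]
  · -- at the midpoint `trans` takes the other branch, so that point has to be left out
    refine intervalIntegral.integral_congr_ae (Filter.Eventually.of_forall fun t ht ↦ ?_)
    rw [uIoc_of_le (by norm_num)] at ht
    have e : (a.trans b).toFun t = reparam secondHalf b.toCotangentPath t := if_neg (not_le.2 ht.1)
    rw [e]

/-- Integration along a cotangent loop, as a linear form on `H¹_Π(M)`. -/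
def integralDual (a : CotangentLoop P x) : Module.Dual ℝ P.Cohomology1 :=
  (P.hamiltonianFields.submoduleOf P.poissonFields).liftQ
    { toFun := fun X ↦ a.integral X.1
      map_add' := fun X Y ↦ a.integral_add X.1 Y.1
      map_smul' := fun r X ↦ a.integral_smul r X.1 }
    fun _ hX ↦ a.integral_eq_zero hX

lemma integralDual_mk (a : CotangentLoop P x) (X : P.poissonFields) :
    a.integralDual (Submodule.Quotient.mk X) = a.integral X := rfl

lemma integralDual_trans (a b : CotangentLoop P x) :
    (a.trans b).integralDual = a.integralDual + b.integralDual := by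
  refine LinearMap.ext fun ξ ↦ ?_
  obtain ⟨X, rfl⟩ := Submodule.Quotient.mk_surjective _ ξ
  exact a.integral_trans b X.1

variable [T2Space M] {nabla : AffineConnection E M}
  [CovariantDerivative.ContMDiffCovariantDerivative nabla ∞]

lemma Homotopic.integralDual_eq {a b : CotangentLoop P x} (h : Homotopic nabla a b) :
    a.integralDual = b.integralDual := by
  refine LinearMap.ext fun ξ ↦ ?_
  obtain ⟨X, rfl⟩ := Submodule.Quotient.mk_surjective _ ξ
  exact CotangentPath.Homotopic.integral_eq h X.2

end CotangentLoop

/-- Integration as a homomorphism `Σ(M, x) → H¹_Π(M)^*`. -/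
def IsotropyGroup.integralHom [T2Space M] (P : PoissonStructure E M)
    (nabla : AffineConnection E M) [CovariantDerivative.ContMDiffCovariantDerivative nabla ∞]
    (x : M) :
    IsotropyGroup P nabla x →* Multiplicative (Module.Dual ℝ P.Cohomology1) :=
  MonoidHom.mk'
    (Quotient.lift (fun a ↦ Multiplicative.ofAdd a.integralDual) fun _ _ h ↦
      congrArg Multiplicative.ofAdd (CotangentLoop.Homotopic.integralDual_eq h))
    (by
      rintro ⟨a⟩ ⟨b⟩
      exact congrArg Multiplicative.ofAdd (a.integralDual_trans b))

end

end PoissonGeometry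

end

theorem proposition2
    {E : Type*} [NormedAddCommGroup E] [NormedSpace ℝ E] [FiniteDimensional ℝ E]
    {M : Type*} [TopologicalSpace M] [ChartedSpace E M] [IsManifold 𝓘(ℝ, E) ∞ M]
    [T2Space M] [ParacompactSpace M]
    (P : PoissonGeometry.PoissonStructure E M)
    (nabla : PoissonGeometry.AffineConnection E M) [CovariantDerivative.ContMDiffCovariantDerivative nabla ∞] :
    (∀ a₀ a₁ : PoissonGeometry.CotangentPath P, a₀.Homotopic nabla a₁ →
      ∀ X ∈ P.poissonFields, a₀.integral X = a₁.integral X) ∧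
    ∀ x : M, ∃ φ : PoissonGeometry.IsotropyGroup P nabla x →*
        Multiplicative (Module.Dual ℝ P.Cohomology1),
      ∀ (a : PoissonGeometry.CotangentLoop P x) (X : P.poissonFields),
        (φ (PoissonGeometry.IsotropyGroup.mk nabla a)).toAdd (Submodule.Quotient.mk X)
          = a.integral X :=
  ⟨fun _ _ h _ hX ↦ h.integral_eq hX, fun x ↦
    ⟨PoissonGeometry.IsotropyGroup.integralHom P nabla x, fun a X ↦ a.integralDual_mk X⟩⟩
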